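/- For $n\ge 1$ and a real-valued potential $V\in L^1_{\mathrm{loc}}(\mathbb R^n)$ with $V\ge 0$ a.e., let $H_V=-\Delta+V$ be the operator on $L^2(\mathbb R^n)$ associated with the closed quadratic form $f\mapsto\int_{\mathbb R^n}(|\nabla f|^2+V|f|^2)\,dx$ with domain $\{f\in H^1(\mathbb R^n):\sqrt V f\in L^2(\mathbb R^n)\}$. Let $n\ge1$ be an integer and $\beta>0$. There is a constant $\lambda_*>0$, depending only on $\beta$ and $n$, such that the following holds for every $c>0$ and every real-valued $V\in L^1_{\mathrm{loc}}(\mathbb R^n)$ with $V(x)\ge c|x|^\beta$ for almost every $x$. Put $\mu_*=c^{\frac{2}{\beta+2}}\lambda_*$. 1. $H_V$ is self-adjoint and has a lowest eigenvalue $\lambda_0(V)$, and $$\lambda_0(V)\ \ge\ \mu_* = c^{\frac{2}{\beta+2}}\,\lambda_* .$$ 2. As a consequence, for all $r,s,t>0$ and all $f\in L^2(\mathbb R^n)$, $$\bigl\|e^{-tH_{rV}^s}f\bigr\|_{L^2(\mathbb R^n)}\ \le\ e^{-t\,r^{\frac{2s}{\beta+2}}\mu_*^{\,s}}\,\|f\|_{L^2(\mathbb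 R^n)},$$ where $H_{rV}=-\Delta+rV$, the operator $1+H_{rV}$ has a bounded inverse on $L^2(\mathbb R^n)$, and $e^{-tH_{rV}^s}$ is defined by the functional calculus of the non-negative self-adjoint operator $H_{rV}$. -/

import Mathlib

open MeasureTheory
open scoped SchwartzMap LineDeriv

noncomputable section

namespace Schrodinger

/-! ### Unbounded operators on a complex Hilbert space -/

section Abstract

variable {E : Type*} [NormedAddCommGroup E] [InnerProductSpace ℂ E]

/-- The real number `a` is an eigenvalue of the unbounded operator `T`: there is a nonzero vector
`f` in the domain of `T` with `T f = a f`. -/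
def IsEigenvalue (T : E →ₗ.[ℂ] E) (a : ℝ) : Prop :=
  ∃ f : T.domain, f ≠ 0 ∧ T f = (a : ℂ) • (f : E)

/-- The bounded everywhere defined operator `S` is the inverse of `1 + T`, i.e. `S = (1 + T)⁻¹`. -/
def IsInverseOneAdd (T : E →ₗ.[ℂ] E) (S : E →L[ℂ] E) : Prop :=
  (∀ g : E, ∃ h : S g ∈ T.domain, S g + T ⟨S g, h⟩ = g) ∧
    ∀ f : T.domain, S (f + T f) = f

/-- A bounded inverse of `1 + T` is unique. -/
theorem IsInverseOneAdd.unique {T : E →ₗ.[ℂ] E} {S S' : E →L[ℂ] E}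
    (h : IsInverseOneAdd T S) (h' : IsInverseOneAdd T S') : S = S' := by
  ext g
  obtain ⟨hg, hg'⟩ := h'.1 g
  have := h.2 ⟨S' g, hg⟩
  rw [hg'] at this
  exact this

open scoped Classical in
/-- The resolvent `(1 + T)⁻¹`. It exists for every nonnegative self-adjoint operator `T`;
by convention the value is `0` if `1 + T` has no bounded inverse. -/
def inverseOneAdd (T : E →ₗ.[ℂ] E) : E →L[ℂ] E :=
  if h : ∃ S : E →L[ℂ] E, IsInverseOneAdd T S then h.choose else 0

theorem IsInverseOneAdd.inverseOneAdd_eq {T : E →ₗ.[ℂ] E} {S : E →L[ℂ] E}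
    (h : IsInverseOneAdd T S) : inverseOneAdd T = S := by
  have h' : ∃ S : E →L[ℂ] E, IsInverseOneAdd T S := ⟨S, h⟩
  rw [inverseOneAdd, dif_pos h']
  exact h'.choose_spec.unique h

/-- The operator `exp (-t T ^ s)` (`s, t > 0`) for a nonnegative self-adjoint operator `T`,
given by the functional calculus of `T`. The change of variable `x = 1 / (1 + a)` maps the
spectrum of `T` into that of the bounded self-adjoint operator `(1 + T)⁻¹`, which is contained in
`[0, 1]`, and turns the function `a ↦ exp (-t a ^ s)` on `[0, ∞)` into
`x ↦ exp (-t (1 / x - 1) ^ s)` on `(0, 1]`, which extends continuously by `0` to `x = 0`; this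
function is applied to `(1 + T)⁻¹` by the continuous functional calculus. -/
def expNegPow [CompleteSpace E] (T : E →ₗ.[ℂ] E) (s t : ℝ) : E →L[ℂ] E :=
  cfc (fun x : ℝ => if 0 < x then Real.exp (-t * (1 / x - 1) ^ s) else 0) (inverseOneAdd T)

end Abstract

/-! ### The operator `-Δ + V` on `L²(ℝⁿ)` -/

/-- The Hilbert space `L²(ℝⁿ)` of complex valued functions. -/
abbrev L2 (n : ℕ) : Type :=
  Lp ℂ 2 (volume : Measure (EuclideanSpace ℝ (Fin n)))

/-- `F` is the gradient of `f` in the sense of distributions; `F i` is the `i`-th partial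
derivative of `f`. So `f ∈ H¹(ℝⁿ)` iff such an `F` exists, and then `F` is unique. -/
def IsGradient {n : ℕ} (f : L2 n) (F : Fin n → L2 n) : Prop :=
  ∀ i : Fin n, ∂_{EuclideanSpace.single i (1 : ℝ)} (f : 𝓢'(EuclideanSpace ℝ (Fin n), ℂ)) =
    (F i : 𝓢'(EuclideanSpace ℝ (Fin n), ℂ))

/-- For a nonnegative potential `V`, the form domain `{f ∈ H¹ : √V f ∈ L²}` of `-Δ + V`,
as the space of all triples `(f, ∇f, √V f)`. -/
def formTriples {n : ℕ} (V : EuclideanSpace ℝ (Fin n) → ℝ) :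
    Submodule ℂ (L2 n × (Fin n → L2 n) × L2 n) where
  carrier := {p | IsGradient p.1 p.2.1 ∧
    ∀ᵐ x : EuclideanSpace ℝ (Fin n), p.2.2 x = (Real.sqrt (V x) : ℂ) * p.1 x}
  zero_mem' := by
    refine ⟨fun i => ?_, ?_⟩
    · change ∂_{_} (Lp.toTemperedDistributionCLM ℂ volume 2 (0 : L2 n)) =
        Lp.toTemperedDistributionCLM ℂ volume 2 (0 : L2 n)
      rw [map_zero, LineDeriv.lineDerivOp_zero]
    · exact Filter.Eventually.of_forall fun x => by simp
  add_mem' := by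
    rintro ⟨f, F, W⟩ ⟨f', F', W'⟩ ⟨h1, h2⟩ ⟨h1', h2'⟩
    refine ⟨fun i => ?_, ?_⟩
    · have e := h1 i
      have e' := h1' i
      change ∂_{_} (Lp.toTemperedDistributionCLM ℂ volume 2 f) =
        Lp.toTemperedDistributionCLM ℂ volume 2 (F i) at e
      change ∂_{_} (Lp.toTemperedDistributionCLM ℂ volume 2 f') =
        Lp.toTemperedDistributionCLM ℂ volume 2 (F' i) at e'
      change ∂_{_} (Lp.toTemperedDistributionCLM ℂ volume 2 (f + f')) =
        Lp.toTemperedDistributionCLM ℂ volume 2 (F i + F' i)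
      rw [map_add, map_add, LineDeriv.lineDerivOp_add, e, e']
    · filter_upwards [h2, h2', Lp.coeFn_add f f', Lp.coeFn_add W W'] with x a b c d
      simp only [Prod.mk_add_mk] at *
      rw [c, d]
      simp only [Pi.add_apply]
      rw [a, b, mul_add]
  smul_mem' := by
    rintro k ⟨f, F, W⟩ ⟨h1, h2⟩
    refine ⟨fun i => ?_, ?_⟩
    · have e := h1 i
      change ∂_{_} (Lp.toTemperedDistributionCLM ℂ volume 2 f) =
        Lp.toTemperedDistributionCLM ℂ volume 2 (F i) at e
      change ∂_{_} (Lp.toTemperedDistributionCLM ℂ volume 2 (k • f)) =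
        Lp.toTemperedDistributionCLM ℂ volume 2 (k • F i)
      rw [map_smul, map_smul, LineDeriv.lineDerivOp_smul, e]
    · filter_upwards [h2, Lp.coeFn_smul k f, Lp.coeFn_smul k W] with x a c d
      simp only [Prod.smul_mk] at *
      rw [c, d]
      simp only [Pi.smul_apply, smul_eq_mul]
      rw [a]
      ring

/-- The quadratic form `∫ (conj ∇v) · ∇f + V (conj v) f` of `-Δ + V`, evaluated on two triples
`p = (v, ∇v, √V v)` and `q = (f, ∇f, √V f)`. -/
def form {n : ℕ} (p q : L2 n × (Fin n → L2 n) × L2 n) : ℂ :=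
  ∑ i, inner ℂ (p.2.1 i) (q.2.1 i) + inner ℂ p.2.2 q.2.2

/-- The graph of `-Δ + V`: all pairs `(f, g)` such that `f` lies in the form domain and
`∫ (conj ∇v) · ∇f + V (conj v) f = ∫ (conj v) g` for all `v` in the form domain. -/
def operatorGraph {n : ℕ} (V : EuclideanSpace ℝ (Fin n) → ℝ) :
    Submodule ℂ (L2 n × L2 n) where
  carrier := {a | ∃ q ∈ formTriples V, q.1 = a.1 ∧
    ∀ p ∈ formTriples V, form p q = inner ℂ p.1 a.2}
  zero_mem' := ⟨0, Submodule.zero_mem _, rfl, fun p _ => by simp [form]⟩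
  add_mem' := by
    rintro a b ⟨q, hq, e, h⟩ ⟨q', hq', e', h'⟩
    refine ⟨q + q', Submodule.add_mem _ hq hq', by simp [e, e'], fun p hp => ?_⟩
    rw [Prod.snd_add, inner_add_right, ← h p hp, ← h' p hp]
    simp only [form, Prod.snd_add, Prod.fst_add, Pi.add_apply, inner_add_right,
      Finset.sum_add_distrib]
    ring
  smul_mem' := by
    rintro k a ⟨q, hq, e, h⟩
    refine ⟨k • q, Submodule.smul_mem _ k hq, by simp [e], fun p hp => ?_⟩
    rw [Prod.smul_snd, inner_smul_right, ← h p hp]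
    simp only [form, Prod.smul_snd, Prod.smul_fst, Pi.smul_apply, inner_smul_right,
      ← Finset.mul_sum, mul_add]

/-- The Schrödinger operator `H_V = -Δ + V` on `L²(ℝⁿ)`, for a nonnegative locally integrable
potential `V`: the self-adjoint operator associated with the closed quadratic form
`f ↦ ∫ |∇f|² + V |f|²` on `{f ∈ H¹ : √V f ∈ L²}`. -/
def hamiltonian {n : ℕ} (V : EuclideanSpace ℝ (Fin n) → ℝ) : L2 n →ₗ.[ℂ] L2 n :=
  (operatorGraph V).toLinearPMap

end Schrodinger

end

/-!
Let `J` be the embedding of the form domain, with the Hilbert space norm of the form of `1 - Δ + V`,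
into `L²`. By the definition of the operator, `(f, g)` lies in its graph iff `f = J J* (f + g)`
(`mem_operatorGraph_iff`), so the resolvent is `S = J J*`, a bounded positive operator. It is
injective because the range of `J`, which contains the test functions, is dense. An operator whose
graph is that of `S⁻¹ - 1` is self-adjoint (`isSelfAdjoint_of_graph`), and its eigenvalues are the
numbers `1 / x - 1` with `x` an eigenvalue of `S`. If `S` is compact, then `‖S‖` belongs to the
spectrum of `S` and hence is an eigenvalue, so `1 / ‖S‖ - 1` is the lowest eigenvalue
(`isLeast_eigenvalue`).

*Lower bound.* For a real bounded smooth `h`, expanding `0 ≤ ‖∂₁f + h f‖²` and integrating by parts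
gives `∫ (∂₁h - h²) |f|² ≤ ‖∂₁f‖²`. With `c = κ ^ (β + 2)`, `y = κ x` and
`h = κ 2^(-β) y₁ / (1 + |y|²)` one has `∂₁h - h² + c |x|^β ≥ κ² 2^(-β) / 4` pointwise, and
`κ² = c ^ (2 / (β + 2))`; so `λ_* = 2^(-β) / 4` works (`le_norm_sq_of_mem_formTriples`). It follows
that `‖S‖ ≤ 1 / (1 + μ_*)`, which bounds the lowest eigenvalue from below and, through the
functional calculus of `S`, the semigroup (`norm_expNegPow_le`). The statement about the semigroup
uses this for the potential `r V`, which satisfies the hypothesis with `r c` in place of `c`.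

*Compactness.* A function in the form domain is small outside a large ball because the potential
is large there, and its high frequencies are small because of the gradient. What remains is, on the
ball, given by inner products of `𝓕 f` with truncated plane waves, which form a compact subset of
`L²`; so finitely many of them suffice up to a small error
(`exists_norm_sq_le_of_mem_formTriples`), and `J` is compact.

Integration by parts in `H¹` is done on the Fourier side, where a distributional derivative with
values in `L²` is multiplication by `2πi ⟨ξ, m⟩` (`fourier_ae_eq_of_lineDerivOp_eq`).
-/

noncomputable section

namespace Schrodinger

/-! ### Operators determined by a bounded resolvent -/

section Resolvent

variable {E : Type*} [NormedAddCommGroup E] [InnerProductSpace ℂ E]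

/-- The hypothesis `hT` says that the graph of `T` is that of `S⁻¹ - 1`. -/
theorem isInverseOneAdd_of_graph {T : E →ₗ.[ℂ] E} {S : E →L[ℂ] E}
    (hT : ∀ a b : E, (a, b) ∈ T.graph ↔ a = S (a + b)) : IsInverseOneAdd T S := by
  refine ⟨fun g => ?_, fun f => ?_⟩
  · have h : (S g, g - S g) ∈ T.graph := by simp [hT]
    obtain ⟨y, hy, hy'⟩ := (LinearPMap.mem_graph_iff _).1 h
    have hmem : S g ∈ T.domain := by
      have h2 := y.2
      rwa [show (y : E) = S g from hy] at h2
    refine ⟨hmem, ?_⟩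
    have : y = ⟨S g, hmem⟩ := Subtype.ext hy
    rw [← this, hy']
    exact add_sub_cancel _ _
  · exact ((hT _ _).1 (T.mem_graph f)).symm

/-- Symmetry of `S` gives `T ≤ T†`; conversely, testing `T†` against the vectors `S u` shows that
every pair in its graph satisfies the equation that characterizes the graph of `T`. -/
theorem isSelfAdjoint_of_graph [CompleteSpace E] {T : E →ₗ.[ℂ] E} {S : E →L[ℂ] E}
    (hS : IsSelfAdjoint S) (hinj : Function.Injective S)
    (hT : ∀ a b : E, (a, b) ∈ T.graph ↔ a = S (a + b)) : IsSelfAdjoint T := by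
  have hinv := isInverseOneAdd_of_graph hT
  have hsymm : ∀ x y : E, inner ℂ (S x) y = inner ℂ x (S y) := fun x y => by
    conv_lhs => rw [← hS.adjoint_eq]
    exact ContinuousLinearMap.adjoint_inner_left _ _ _
  have hdense : Dense (T.domain : Set E) := by
    rw [Submodule.dense_iff_topologicalClosure_eq_top,
      Submodule.topologicalClosure_eq_top_iff, Submodule.eq_bot_iff]
    intro x hx
    apply hinj
    rw [map_zero, ← inner_self_eq_zero (𝕜 := ℂ), hsymm, ← hsymm]
    obtain ⟨h, -⟩ := hinv.1 (S x)
    rw [hsymm]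
    exact (Submodule.mem_orthogonal' _ _).1 hx _ h
  rw [LinearPMap.isSelfAdjoint_def]
  have hformal : T.IsFormalAdjoint T := by
    intro x y
    have hx := hinv.2 x
    have hy := hinv.2 y
    have := hsymm ((x : E) + T x) ((y : E) + T y)
    rw [hx, hy, inner_add_left, inner_add_right] at this
    exact (add_left_cancel this).symm
  refine le_antisymm ?_ (hformal.le_adjoint hdense)
  refine LinearPMap.le_of_le_graph fun p hp => ?_
  obtain ⟨y, z⟩ := p
  obtain ⟨w, hw, hw'⟩ := (LinearPMap.mem_graph_iff _).1 hp
  rw [hT]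
  refine ext_inner_right ℂ fun u => ?_
  obtain ⟨h, hu⟩ := hinv.1 u
  have := LinearPMap.adjoint_isFormalAdjoint hdense w ⟨S u, h⟩
  rw [eq_sub_of_add_eq' hu] at this
  dsimp only at hw hw'
  rw [hw', hw, inner_sub_right] at this
  rw [hsymm, inner_add_left]
  linear_combination -this

theorem isEigenvalue_iff_of_graph {T : E →ₗ.[ℂ] E} {S : E →L[ℂ] E}
    (hT : ∀ a b : E, (a, b) ∈ T.graph ↔ a = S (a + b)) (a : ℝ) :
    IsEigenvalue T a ↔ ∃ f : E, f ≠ 0 ∧ f = (1 + a : ℂ) • S f := by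
  have key : ∀ f : E, f = (1 + a : ℂ) • S f ↔ (f, (a : ℂ) • f) ∈ T.graph := fun f => by
    rw [hT, ← map_smul, add_smul, one_smul]
  constructor
  · rintro ⟨f, hf, h⟩
    refine ⟨f, by simpa using hf, (key _).2 ?_⟩
    rw [← h]
    exact T.mem_graph f
  · rintro ⟨f, hf, h⟩
    obtain ⟨y, hy, hy'⟩ := (LinearPMap.mem_graph_iff _).1 ((key f).1 h)
    dsimp only at hy hy'
    refine ⟨y, fun h0 => hf (by rw [← hy, h0]; rfl), ?_⟩
    rw [hy', hy]

variable [CompleteSpace E]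

/-- For positive compact `S` the norm `‖S‖` is the largest eigenvalue of `S`. -/
theorem isLeast_eigenvalue [Nontrivial E] {T : E →ₗ.[ℂ] E} {S : E →L[ℂ] E}
    (hS : S.IsPositive) (hinj : Function.Injective S) (hc : IsCompactOperator S)
    (hT : ∀ a b : E, (a, b) ∈ T.graph ↔ a = S (a + b)) :
    IsLeast {a : ℝ | IsEigenvalue T a} (1 / ‖S‖ - 1) := by
  have hS0 : 0 < ‖S‖ := by
    rw [norm_pos_iff]
    rintro rfl
    obtain ⟨x, hx⟩ := exists_ne (0 : E)
    exact hx (hinj (by simp))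
  constructor
  · rw [Set.mem_ofPred_eq, isEigenvalue_iff_of_graph hT]
    have hmem := CStarAlgebra.norm_mem_spectrum_of_nonneg
      ((ContinuousLinearMap.nonneg_iff_isPositive S).2 hS)
    have hmem' : ((‖S‖ : ℝ) : ℂ) ∈ spectrum ℂ S := spectrum.algebraMap_mem ℂ hmem
    rw [← hc.hasEigenvalue_iff_mem_spectrum (by exact_mod_cast hS0.ne')] at hmem'
    obtain ⟨f, hf⟩ := hmem'.exists_hasEigenvector
    refine ⟨f, hf.2, ?_⟩
    have : S f = ((‖S‖ : ℝ) : ℂ) • f := hf.apply_eq_smul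
    rw [this, smul_smul]
    push_cast
    have h0 : ((‖S‖ : ℝ) : ℂ) ≠ 0 := by exact_mod_cast hS0.ne'
    rw [add_sub_cancel, one_div, inv_mul_cancel₀ h0, one_smul]
  · intro a ha
    rw [Set.mem_ofPred_eq, isEigenvalue_iff_of_graph hT] at ha
    obtain ⟨f, hf, h⟩ := ha
    have hf0 : 0 < ‖f‖ := norm_pos_iff.2 hf
    have hpos : 0 < 1 + a := by
      have h1 := hS.re_inner_nonneg_right f
      by_contra! hneg
      have h2 : inner ℂ f f = (1 + a : ℂ) * inner ℂ f (S f) := by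
        rw [← inner_smul_right, ← h]
      rw [inner_self_eq_norm_sq_to_K] at h2
      have h3 := congrArg Complex.re h2
      rw [show (1 + a : ℂ) = ((1 + a : ℝ) : ℂ) by push_cast; rfl, Complex.re_ofReal_mul] at h3
      have h4 : ‖f‖ ^ 2 = (1 + a) * (inner ℂ f (S f)).re := by
        rw [← h3]; norm_cast
      have : (1 + a) * (inner ℂ f (S f)).re ≤ 0 := mul_nonpos_of_nonpos_of_nonneg hneg h1
      nlinarith
    have h1 : ‖f‖ ≤ (1 + a) * (‖S‖ * ‖f‖) := by
      calc ‖f‖ = ‖(1 + a : ℂ) • S f‖ := by rw [← h]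
        _ = (1 + a) * ‖S f‖ := by
          rw [norm_smul, show (1 + a : ℂ) = ((1 + a : ℝ) : ℂ) by push_cast; rfl,
            Complex.norm_real, Real.norm_of_nonneg hpos.le]
        _ ≤ _ := by gcongr; exact S.le_opNorm f
    rw [sub_le_iff_le_add', div_le_iff₀ hS0]
    nlinarith

/-- A lower bound `μ` for `T` gives `(1 + T)⁻¹ ≤ 1 / (1 + μ)`, and the function that `expNegPow`
applies to `(1 + T)⁻¹` is increasing on `(0, 1]`. -/
theorem norm_expNegPow_le {T : E →ₗ.[ℂ] E} {S : E →L[ℂ] E} {s t μ : ℝ} (hs : 0 < s) (ht : 0 < t)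
    (hμ : 0 ≤ μ) (h : IsInverseOneAdd T S) (hS : ‖S‖ ≤ 1 / (1 + μ)) :
    ‖expNegPow T s t‖ ≤ Real.exp (-t * μ ^ s) := by
  rw [expNegPow, h.inverseOneAdd_eq]
  refine norm_cfc_le (Real.exp_pos _).le fun x hx => ?_
  split_ifs with h0
  · have hx1 : x ≤ 1 / (1 + μ) := by
      have h1 : ((x : ℝ) : ℂ) ∈ spectrum ℂ S := spectrum.algebraMap_mem ℂ hx
      have h2 := spectrum.norm_le_norm_mul_of_mem h1
      rw [Complex.norm_real, Real.norm_of_nonneg h0.le] at h2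
      have h3 : ‖(1 : E →L[ℂ] E)‖ ≤ 1 := ContinuousLinearMap.norm_id_le
      nlinarith [norm_nonneg S]
    rw [Real.norm_of_nonneg (Real.exp_pos _).le, Real.exp_le_exp]
    have h4 : μ ≤ 1 / x - 1 := by
      rw [le_div_iff₀ (by positivity)] at hx1
      rw [le_sub_iff_add_le, le_div_iff₀ h0]
      linarith
    have := Real.rpow_le_rpow hμ h4 hs.le
    nlinarith
  · rw [norm_zero]
    exact (Real.exp_pos _).le

end Resolvent

section Compact

/-- Ehrling-type criterion: `T` is compact if, up to arbitrarily small multiples of the norm,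
it is dominated by compact operators. -/
theorem isCompactOperator_of_forall_norm_le {X Z : Type*} [NormedAddCommGroup X]
    [NormedSpace ℂ X] [NormedAddCommGroup Z] [NormedSpace ℂ Z] [CompleteSpace Z] (T : X →L[ℂ] Z)
    (h : ∀ ε : ℝ, 0 < ε → ∃ (N : ℕ) (Φ : X →L[ℂ] (Fin N → ℂ)), ∀ x, ‖T x‖ ≤ ε * ‖x‖ + ‖Φ x‖) :
    IsCompactOperator T := by
  refine (isCompactOperator_iff_isCompact_closure_image_closedBall (T : X →ₗ[ℂ] Z) one_pos).2 ?_
  refine (TotallyBounded.closure ?_).isCompact_of_isClosed isClosed_closure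
  rw [Metric.totallyBounded_iff]
  intro ε hε
  obtain ⟨N, Φ, hΦ⟩ := h (ε / 4) (by positivity)
  have htb : TotallyBounded (Φ '' Metric.closedBall 0 1) :=
    (Φ.lipschitz.isBounded_image Metric.isBounded_closedBall).isCompact_closure.totallyBounded.subset
      subset_closure
  obtain ⟨u, hu, huf, hcov⟩ :=
    Set.exists_subset_image_finite_and.1 (Metric.finite_approx_of_totallyBounded htb (ε / 4)
      (by positivity))
  refine ⟨T '' u, huf.image _, ?_⟩
  rintro _ ⟨x, hx, rfl⟩
  obtain ⟨_, ⟨y, hy, rfl⟩, hxy⟩ := Set.mem_iUnion₂.1 (hcov (Set.mem_image_of_mem Φ hx))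
  refine Set.mem_iUnion₂.2 ⟨T y, Set.mem_image_of_mem _ hy, ?_⟩
  rw [Metric.mem_ball, dist_eq_norm, ← map_sub] at hxy
  have hd : ‖x - y‖ ≤ 2 := by
    have h1 := mem_closedBall_zero_iff.1 hx
    have h2 := mem_closedBall_zero_iff.1 (hu hy)
    linarith [norm_sub_le x y]
  have h3 := hΦ (x - y)
  rw [Metric.mem_ball, dist_eq_norm]
  change ‖T x - T y‖ < ε
  rw [← map_sub]
  nlinarith

end Compact

/-! ### Distributional derivatives in `L²` -/

section Gradient

open scoped FourierTransform
open TemperedDistribution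

variable {n : ℕ}

theorem toTemperedDistribution_injective {f g : L2 n}
    (h : (f : 𝓢'(EuclideanSpace ℝ (Fin n), ℂ)) = (g : 𝓢'(EuclideanSpace ℝ (Fin n), ℂ))) :
    f = g := by
  have := Lp.ker_toTemperedDistributionCLM_eq_bot (F := ℂ) (p := 2)
    (μ := (volume : Measure (EuclideanSpace ℝ (Fin n))))
  exact LinearMap.ker_eq_bot.1 this h

/-- Both sides are only known to agree as distributions; multiplying by the symbol
`(1 + |ξ|²)⁻¹` makes them elements of `L²`, where equality can be tested almost everywhere. -/
theorem fourier_ae_eq_of_lineDerivOp_eq {f F : L2 n} {m : EuclideanSpace ℝ (Fin n)}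
    (h : ∂_{m} (f : 𝓢'(EuclideanSpace ℝ (Fin n), ℂ)) = (F : 𝓢'(EuclideanSpace ℝ (Fin n), ℂ))) :
    ∀ᵐ ξ, 𝓕 F ξ = (2 * Real.pi * Complex.I * (inner ℝ ξ m : ℝ)) * 𝓕 f ξ := by
  set w : EuclideanSpace ℝ (Fin n) → ℂ := fun ξ => (((1 + ‖ξ‖ ^ 2) ^ (-1 : ℝ) : ℝ) : ℂ) with hw
  set w' : EuclideanSpace ℝ (Fin n) → ℂ := fun ξ => ((inner ℝ ξ m : ℝ) : ℂ) with hw'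
  have hwt : w.HasTemperateGrowth := by fun_prop
  have hwt' : w'.HasTemperateGrowth := by fun_prop
  have hwn : ∀ ξ, ‖w ξ‖ = (1 + ‖ξ‖ ^ 2)⁻¹ := fun ξ => by
    rw [hw, Complex.norm_real, Real.norm_of_nonneg (by positivity), Real.rpow_neg_one]
  have hwL : MemLp w ⊤ (volume : Measure (EuclideanSpace ℝ (Fin n))) := by
    refine memLp_top_of_bound hwt.1.continuous.aestronglyMeasurable 1 (.of_forall fun ξ => ?_)
    rw [hwn]
    exact inv_le_one_of_one_le₀ (by nlinarith [sq_nonneg ‖ξ‖])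
  have hwL' : MemLp (w' * w) ⊤ (volume : Measure (EuclideanSpace ℝ (Fin n))) := by
    refine memLp_top_of_bound (hwt'.1.continuous.mul hwt.1.continuous).aestronglyMeasurable ‖m‖
      (.of_forall fun ξ => ?_)
    rw [Pi.mul_apply, norm_mul, hwn, hw', Complex.norm_real, Real.norm_eq_abs,
      mul_inv_le_iff₀ (by positivity)]
    have h1 := abs_real_inner_le_norm ξ m
    nlinarith [norm_nonneg m, norm_nonneg ξ, sq_nonneg (‖ξ‖ - 1)]
  have key : (hwL.toLp w • 𝓕 F : L2 n) = (2 * Real.pi * Complex.I : ℂ) •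
      (hwL'.toLp (w' * w) • 𝓕 f : L2 n) := by
    apply toTemperedDistribution_injective
    have e1 : ((2 * Real.pi * Complex.I : ℂ) • (hwL'.toLp (w' * w) • 𝓕 f : L2 n) : L2 n) =
      (Lp.toTemperedDistributionCLM ℂ volume 2 ((2 * Real.pi * Complex.I : ℂ) •
        (hwL'.toLp (w' * w) • 𝓕 f : L2 n)) : 𝓢'(EuclideanSpace ℝ (Fin n), ℂ)) := rfl
    rw [e1, map_smul, Lp.toTemperedDistributionCLM_apply,
      Lp.toTemperedDistribution_smul_eq hwt hwL,
      Lp.toTemperedDistribution_smul_eq (hwt'.mul hwt) hwL',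
      ← smulLeftCLM_smulLeftCLM_apply hwt' hwt, ← map_smul,
      ← Lp.fourier_toTemperedDistribution_eq, ← Lp.fourier_toTemperedDistribution_eq, ← h,
      fourier_lineDerivOp_eq]
  have e2 := Lp.coeFn_lpSMul (r := 2) (hwL.toLp w) (𝓕 F)
  have e3 := Lp.coeFn_lpSMul (r := 2) (hwL'.toLp (w' * w)) (𝓕 f)
  have e4 := Lp.coeFn_smul (2 * Real.pi * Complex.I : ℂ) (hwL'.toLp (w' * w) • 𝓕 f : L2 n)
  rw [← key] at e4
  filter_upwards [e2, e3, e4, hwL.coeFn_toLp, hwL'.coeFn_toLp] with ξ h2 h3 h4 h5 h6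
  rw [h4, Pi.smul_apply, h3, Pi.smul_apply', Pi.smul_apply', h5, h6] at h2
  have h0 : w ξ ≠ 0 := by
    rw [← norm_pos_iff, hwn]; positivity
  apply mul_left_cancel₀ h0
  simp only [smul_eq_mul, Pi.mul_apply] at h2
  rw [← h2]
  ring

/-- Integration by parts in `H¹`: the Fourier symbol of a derivative is purely imaginary. -/
theorem inner_lineDerivOp_eq_neg {f F g G : L2 n} {m : EuclideanSpace ℝ (Fin n)}
    (hf : ∂_{m} (f : 𝓢'(EuclideanSpace ℝ (Fin n), ℂ)) = (F : 𝓢'(EuclideanSpace ℝ (Fin n), ℂ)))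
    (hg : ∂_{m} (g : 𝓢'(EuclideanSpace ℝ (Fin n), ℂ)) = (G : 𝓢'(EuclideanSpace ℝ (Fin n), ℂ))) :
    inner ℂ F g = -inner ℂ f G := by
  rw [← Lp.inner_fourier_eq, ← Lp.inner_fourier_eq f, L2.inner_def, L2.inner_def, ← integral_neg]
  refine integral_congr_ae ?_
  filter_upwards [fourier_ae_eq_of_lineDerivOp_eq hf, fourier_ae_eq_of_lineDerivOp_eq hg]
    with ξ h1 h2
  rw [h1, h2]
  simp only [RCLike.inner_apply, map_mul, Complex.conj_I, Complex.conj_ofReal, map_ofNat]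
  ring

/-- Leibniz rule for the product of an `H¹` function and a smooth function. -/
theorem lineDerivOp_smul_eq {f F : L2 n} {m : EuclideanSpace ℝ (Fin n)}
    (hf : ∂_{m} (f : 𝓢'(EuclideanSpace ℝ (Fin n), ℂ)) = (F : 𝓢'(EuclideanSpace ℝ (Fin n), ℂ)))
    {h h' : EuclideanSpace ℝ (Fin n) → ℂ} (ht : h.HasTemperateGrowth)
    (ht' : h'.HasTemperateGrowth) (hd : ∀ x, HasLineDerivAt ℝ h (h' x) x m)
    (hb : MemLp h ⊤ volume) (hb' : MemLp h' ⊤ volume) :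
    ∂_{m} ((hb.toLp h • f : L2 n) : 𝓢'(EuclideanSpace ℝ (Fin n), ℂ)) =
      ((hb'.toLp h' • f + hb.toLp h • F : L2 n) : 𝓢'(EuclideanSpace ℝ (Fin n), ℂ)) := by
  have e : ((hb'.toLp h' • f + hb.toLp h • F : L2 n) : 𝓢'(EuclideanSpace ℝ (Fin n), ℂ)) =
      ((hb'.toLp h' • f : L2 n) : 𝓢'(EuclideanSpace ℝ (Fin n), ℂ)) +
      ((hb.toLp h • F : L2 n) : 𝓢'(EuclideanSpace ℝ (Fin n), ℂ)) :=
    map_add (Lp.toTemperedDistributionCLM ℂ volume 2) _ _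
  rw [e, Lp.toTemperedDistribution_smul_eq ht hb, Lp.toTemperedDistribution_smul_eq ht hb,
    Lp.toTemperedDistribution_smul_eq ht' hb', ← hf]
  ext φ
  rw [_root_.add_apply]
  simp only [lineDerivOp_apply_apply, smulLeftCLM_apply_apply]
  rw [← map_add]
  congr 1
  ext x
  have h1 : HasLineDerivAt ℝ φ (∂_{m} φ x) x m := by
    rw [SchwartzMap.lineDerivOp_apply]
    exact (φ.differentiableAt.lineDifferentiableAt).hasLineDerivAt
  have h2 : ∂_{m} (SchwartzMap.smulLeftCLM ℂ h φ) x = h x * ∂_{m} φ x + h' x * φ x := by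
    rw [SchwartzMap.lineDerivOp_apply]
    refine HasLineDerivAt.lineDeriv ?_
    rw [SchwartzMap.smulLeftCLM_apply ht]
    have := HasDerivAt.mul (hd x) h1
    simp only [zero_smul, add_zero] at this
    refine HasDerivAt.congr_deriv this ?_
    ring
  simp [SchwartzMap.smulLeftCLM_apply_apply ht, SchwartzMap.smulLeftCLM_apply_apply ht', h2]

end Gradient

/-! ### The lower bound for the quadratic form -/

section LowerBound

variable {n : ℕ}

theorem norm_sq_eq_integral (f : L2 n) : ‖f‖ ^ 2 = ∫ x, ‖f x‖ ^ 2 := by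
  have h := L2.inner_def (𝕜 := ℂ) f f
  rw [inner_self_eq_norm_sq_to_K] at h
  have h2 : (∫ x, inner ℂ (f x) (f x)) = ((∫ x, ‖f x‖ ^ 2 : ℝ) : ℂ) := by
    rw [← integral_complex_ofReal]
    refine integral_congr_ae (.of_forall fun x => ?_)
    simp only [inner_self_eq_norm_sq_to_K]
    push_cast
    rfl
  rw [h2] at h
  exact Complex.ofReal_injective (by rw [Complex.ofReal_pow]; exact h)

theorem integrable_norm_sq (f : L2 n) : Integrable fun x => ‖f x‖ ^ 2 :=
  (Lp.memLp f).integrable_norm_pow (by norm_num)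

/-- Expanding `0 ≤ ‖∂f + h f‖²` for a real function `h` with derivative `h'`. -/
theorem integral_le_norm_sq_of_lineDerivOp_eq {f F : L2 n} {m : EuclideanSpace ℝ (Fin n)}
    (hf : ∂_{m} (f : 𝓢'(EuclideanSpace ℝ (Fin n), ℂ)) = (F : 𝓢'(EuclideanSpace ℝ (Fin n), ℂ)))
    {h h' : EuclideanSpace ℝ (Fin n) → ℝ} (ht : h.HasTemperateGrowth)
    (ht' : h'.HasTemperateGrowth) (hd : ∀ x, HasLineDerivAt ℝ h (h' x) x m)
    {C C' : ℝ} (hb : ∀ x, |h x| ≤ C) (hb' : ∀ x, |h' x| ≤ C') :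
    ∫ x, (h' x - h x ^ 2) * ‖f x‖ ^ 2 ≤ ‖F‖ ^ 2 := by
  have hL : MemLp (fun x => (h x : ℂ)) ⊤ (volume : Measure (EuclideanSpace ℝ (Fin n))) :=
    memLp_top_of_bound (by
      have := ht.1.continuous
      fun_prop) C (.of_forall fun x => by simpa using hb x)
  have hL' : MemLp (fun x => (h' x : ℂ)) ⊤ (volume : Measure (EuclideanSpace ℝ (Fin n))) :=
    memLp_top_of_bound (by
      have := ht'.1.continuous
      fun_prop) C' (.of_forall fun x => by simpa using hb' x)
  have hg := lineDerivOp_smul_eq hf (h := fun x => (h x : ℂ)) (h' := fun x => (h' x : ℂ))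
    (by fun_prop) (by fun_prop) (fun x => HasDerivAt.ofReal_comp (hd x)) hL hL'
  set u : L2 n := hL.toLp _ • f with hu
  set u' : L2 n := hL'.toLp _ • f with hu'
  have eu : ∀ᵐ x, u x = h x * f x := by
    filter_upwards [Lp.coeFn_lpSMul (r := 2) (hL.toLp _) f, hL.coeFn_toLp] with x h1 h2
    rw [hu, h1, Pi.smul_apply', h2, smul_eq_mul]
  have eu' : ∀ᵐ x, u' x = h' x * f x := by
    filter_upwards [Lp.coeFn_lpSMul (r := 2) (hL'.toLp _) f, hL'.coeFn_toLp] with x h1 h2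
    rw [hu', h1, Pi.smul_apply', h2, smul_eq_mul]
  have ev : ∀ᵐ x, (hL.toLp _ • F : L2 n) x = h x * F x := by
    filter_upwards [Lp.coeFn_lpSMul (r := 2) (hL.toLp _) F, hL.coeFn_toLp] with x h1 h2
    rw [h1, Pi.smul_apply', h2, smul_eq_mul]
  have h1 := inner_lineDerivOp_eq_neg hf hg
  rw [inner_add_right] at h1
  have h2 : inner ℂ f (hL.toLp _ • F : L2 n) = inner ℂ u F := by
    rw [L2.inner_def, L2.inner_def]
    refine integral_congr_ae ?_
    filter_upwards [eu, ev] with x h3 h4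
    rw [h3, h4]
    simp only [RCLike.inner_apply, map_mul, Complex.conj_ofReal]
    ring
  have h3 : inner ℂ f u' = ((∫ x, h' x * ‖f x‖ ^ 2 : ℝ) : ℂ) := by
    rw [L2.inner_def, ← integral_complex_ofReal]
    refine integral_congr_ae ?_
    filter_upwards [eu'] with x h3
    rw [h3]
    simp only [RCLike.inner_apply]
    rw [mul_assoc, Complex.mul_conj']
    push_cast
    rfl
  have h4 : ‖u‖ ^ 2 = ∫ x, h x ^ 2 * ‖f x‖ ^ 2 := by
    rw [norm_sq_eq_integral]
    refine integral_congr_ae ?_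
    filter_upwards [eu] with x h3
    rw [h3, norm_mul, mul_pow, Complex.norm_real, Real.norm_eq_abs, sq_abs]
  have hre : 2 * (inner ℂ F u).re = -∫ x, h' x * ‖f x‖ ^ 2 := by
    have h5 := congrArg Complex.re h1
    rw [h2, h3, Complex.neg_re, Complex.add_re, Complex.ofReal_re] at h5
    have h6 : (inner ℂ u F).re = (inner ℂ F u).re := inner_re_symm (𝕜 := ℂ) u F
    linarith
  have hpos : 0 ≤ ‖F + u‖ ^ 2 := sq_nonneg _
  rw [norm_add_sq (𝕜 := ℂ), RCLike.re_eq_complex_re, hre, h4] at hpos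
  have i1 : Integrable fun x => h' x * ‖f x‖ ^ 2 :=
    (integrable_norm_sq f).bdd_mul ht'.1.continuous.aestronglyMeasurable (.of_forall hb')
  have i2 : Integrable fun x => h x ^ 2 * ‖f x‖ ^ 2 :=
    (integrable_norm_sq f).bdd_mul (c := C ^ 2) (ht.1.continuous.pow 2).aestronglyMeasurable
      (.of_forall fun x => by
        rw [norm_pow]
        exact pow_le_pow_left₀ (norm_nonneg _) (hb x) 2)
  simp only [sub_mul]
  rw [integral_sub i1 i2]
  linarith

variable (κ α : ℝ) (m : EuclideanSpace ℝ (Fin n))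

/-- The function `y ↦ κ α y₁ / (1 + |y|²)` of the rescaled variable `y = κ x`, where `y₁` is the
component of `y` along `m`. -/
def slope (x : EuclideanSpace ℝ (Fin n)) : ℝ :=
  κ ^ 2 * α * inner ℝ x m * (1 + ‖κ • x‖ ^ 2) ^ (-1 : ℝ)

/-- The derivative of `slope` along `m`. -/
def slopeDeriv (x : EuclideanSpace ℝ (Fin n)) : ℝ :=
  κ ^ 2 * α * ((1 + ‖κ • x‖ ^ 2) ^ (-1 : ℝ) -
    2 * κ ^ 2 * (inner ℝ x m) ^ 2 * ((1 + ‖κ • x‖ ^ 2) ^ (-1 : ℝ)) ^ 2)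

theorem hasTemperateGrowth_slope : (slope κ α m).HasTemperateGrowth := by
  have h0 : (fun x : EuclideanSpace ℝ (Fin n) => κ • x).HasTemperateGrowth := by fun_prop
  have h1 : (fun x : EuclideanSpace ℝ (Fin n) => (1 + ‖κ • x‖ ^ 2) ^ (-1 : ℝ)).HasTemperateGrowth :=
    (Function.hasTemperateGrowth_one_add_norm_sq_rpow (EuclideanSpace ℝ (Fin n)) (-1)).comp h0
  unfold slope
  fun_prop

theorem hasTemperateGrowth_slopeDeriv : (slopeDeriv κ α m).HasTemperateGrowth := by
  have h0 : (fun x : EuclideanSpace ℝ (Fin n) => κ • x).HasTemperateGrowth := by fun_prop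
  have h1 : (fun x : EuclideanSpace ℝ (Fin n) => (1 + ‖κ • x‖ ^ 2) ^ (-1 : ℝ)).HasTemperateGrowth :=
    (Function.hasTemperateGrowth_one_add_norm_sq_rpow (EuclideanSpace ℝ (Fin n)) (-1)).comp h0
  unfold slopeDeriv
  simp only [pow_two (inner ℝ _ m), pow_two (_ ^ (-1 : ℝ))]
  fun_prop

variable {m}

theorem hasLineDerivAt_slope (hm : ‖m‖ = 1) (x : EuclideanSpace ℝ (Fin n)) :
    HasLineDerivAt ℝ (slope κ α m) (slopeDeriv κ α m x) x m := by
  have hmm : inner ℝ m m = (1 : ℝ) := by rw [real_inner_self_eq_norm_sq, hm, one_pow]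
  have hfun : (fun t : ℝ => slope κ α m (x + t • m)) = fun t : ℝ =>
      κ ^ 2 * α * (inner ℝ x m + t) *
        (1 + κ ^ 2 * (‖x‖ ^ 2 + 2 * t * inner ℝ x m + t ^ 2))⁻¹ := by
    ext t
    rw [slope, Real.rpow_neg_one, inner_add_left, inner_smul_left, hmm, norm_smul, mul_pow,
      norm_add_sq_real, inner_smul_right, norm_smul, hm, Real.norm_eq_abs, Real.norm_eq_abs,
      mul_one, mul_one, sq_abs, sq_abs]
    simp only [conj_trivial]
    ring
  have hpos : 0 < 1 + κ ^ 2 * ‖x‖ ^ 2 := by positivity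
  unfold HasLineDerivAt
  rw [hfun]
  have d1 : HasDerivAt (fun t : ℝ => κ ^ 2 * α * (inner ℝ x m + t)) (κ ^ 2 * α) 0 := by
    simpa using ((hasDerivAt_id (0 : ℝ)).const_add (inner ℝ x m)).const_mul (κ ^ 2 * α)
  have d2 : HasDerivAt (fun t : ℝ => 1 + κ ^ 2 * (‖x‖ ^ 2 + 2 * t * inner ℝ x m + t ^ 2))
      (κ ^ 2 * (2 * inner ℝ x m)) 0 := by
    have e1 : HasDerivAt (fun t : ℝ => 2 * t * inner ℝ x m) (2 * inner ℝ x m) 0 := by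
      simpa using ((hasDerivAt_id (0 : ℝ)).const_mul 2).mul_const (inner ℝ x m)
    have e2 : HasDerivAt (fun t : ℝ => t ^ 2) 0 0 := by simpa using hasDerivAt_pow 2 (0 : ℝ)
    simpa [add_assoc] using (((e1.add e2).const_add (‖x‖ ^ 2)).const_mul (κ ^ 2)).const_add 1
  have d3 := d1.mul (d2.inv (by simpa using hpos.ne'))
  refine HasDerivAt.congr_deriv d3 ?_
  rw [slopeDeriv, Real.rpow_neg_one, norm_smul, mul_pow, Real.norm_eq_abs, sq_abs]
  simp only [Pi.inv_apply, mul_zero, zero_mul, add_zero, zero_pow two_ne_zero]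
  field_simp
  ring

theorem abs_slope_le (hm : ‖m‖ = 1) (x : EuclideanSpace ℝ (Fin n)) :
    |slope κ α m x| ≤ |κ| * |α| := by
  have h1 := abs_real_inner_le_norm x m
  rw [hm, mul_one] at h1
  rw [slope, Real.rpow_neg_one, abs_mul, abs_mul, abs_mul, abs_inv,
    abs_of_pos (by positivity : 0 < 1 + ‖κ • x‖ ^ 2), mul_inv_le_iff₀ (by positivity), norm_smul,
    Real.norm_eq_abs, abs_pow]
  have h2 : |κ| * |inner ℝ x m| ≤ 1 + (|κ| * ‖x‖) ^ 2 := by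
    have : |κ| * |inner ℝ x m| ≤ |κ| * ‖x‖ := by gcongr
    nlinarith [sq_nonneg (|κ| * ‖x‖ - 1), mul_nonneg (abs_nonneg κ) (norm_nonneg x)]
  calc |κ| ^ 2 * |α| * |inner ℝ x m| = |κ| * |α| * (|κ| * |inner ℝ x m|) := by ring
    _ ≤ _ := by gcongr

theorem abs_slopeDeriv_le (hm : ‖m‖ = 1) (x : EuclideanSpace ℝ (Fin n)) :
    |slopeDeriv κ α m x| ≤ κ ^ 2 * |α| * 3 := by
  have h1 := abs_real_inner_le_norm x m
  rw [hm, mul_one] at h1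
  rw [slopeDeriv, abs_mul, abs_mul, abs_of_nonneg (sq_nonneg κ), Real.rpow_neg_one]
  gcongr
  have h0 : 0 < (1 + ‖κ • x‖ ^ 2)⁻¹ := by positivity
  have hle : (1 + ‖κ • x‖ ^ 2)⁻¹ ≤ 1 := inv_le_one_of_one_le₀ (by nlinarith [sq_nonneg ‖κ • x‖])
  have hp : κ ^ 2 * (inner ℝ x m) ^ 2 * (1 + ‖κ • x‖ ^ 2)⁻¹ ≤ 1 := by
    rw [mul_inv_le_iff₀ (by positivity), norm_smul, mul_pow, Real.norm_eq_abs, sq_abs,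
      ← sq_abs (inner ℝ x m)]
    have : κ ^ 2 * |inner ℝ x m| ^ 2 ≤ κ ^ 2 * ‖x‖ ^ 2 := by gcongr
    linarith
  have hp0 : 0 ≤ κ ^ 2 * (inner ℝ x m) ^ 2 * (1 + ‖κ • x‖ ^ 2)⁻¹ := by positivity
  rw [abs_le]
  constructor <;> nlinarith

/-- The bound on which the constant `2 ^ (-β) / 4` rests. For `|y| ≤ 1 / 2` the derivative of the
slope is large; for `|y| ≥ 1 / 2` the potential `|y| ^ β ≥ 2 ^ (-β)` makes up for its negative
part. -/
theorem le_slopeDeriv_sub_slope_sq_add {β κ : ℝ} (hβ : 0 < β) (hκ : 0 < κ) (hm : ‖m‖ = 1)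
    (x : EuclideanSpace ℝ (Fin n)) :
    κ ^ 2 * ((1 / 2 : ℝ) ^ β / 4) ≤ slopeDeriv κ ((1 / 2) ^ β) m x -
      slope κ ((1 / 2) ^ β) m x ^ 2 + κ ^ (β + 2) * ‖x‖ ^ β := by
  set α : ℝ := (1 / 2 : ℝ) ^ β with hα
  have hα0 : 0 < α := by positivity
  have hα1 : α ≤ 1 := Real.rpow_le_one (by norm_num) (by norm_num) hβ.le
  have h1 := abs_real_inner_le_norm x m
  rw [hm, mul_one] at h1
  set p : ℝ := κ ^ 2 * (inner ℝ x m) ^ 2 with hp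
  set ρ : ℝ := ‖κ • x‖ ^ 2 with hρ
  have hp0 : 0 ≤ p := by positivity
  have hpρ : p ≤ ρ := by
    rw [hp, hρ, norm_smul, mul_pow, Real.norm_eq_abs, sq_abs, ← sq_abs (inner ℝ x m)]
    gcongr
  have hpow : κ ^ (β + 2) * ‖x‖ ^ β = κ ^ 2 * ‖κ • x‖ ^ β := by
    rw [norm_smul, Real.norm_of_nonneg hκ.le, Real.mul_rpow hκ.le (norm_nonneg _),
      Real.rpow_add hκ, Real.rpow_two]
    ring
  have hid : slopeDeriv κ α m x - slope κ α m x ^ 2 + κ ^ (β + 2) * ‖x‖ ^ β =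
      κ ^ 2 * (α * ((1 + ρ - 2 * p - α * p) / (1 + ρ) ^ 2) + ‖κ • x‖ ^ β) := by
    rw [hpow, slopeDeriv, slope, Real.rpow_neg_one, ← hρ, hp]
    have : 0 < 1 + ρ := by positivity
    field_simp
  rw [hid]
  refine mul_le_mul_of_nonneg_left ?_ (sq_nonneg κ)
  have hρ0 : 0 ≤ ρ := sq_nonneg _
  have h2 : 1 - 2 * ρ ≤ 1 + ρ - 2 * p - α * p := by nlinarith
  have h3 : (1 - 2 * ρ) / (1 + ρ) ^ 2 ≤ (1 + ρ - 2 * p - α * p) / (1 + ρ) ^ 2 := by gcongr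
  rcases le_total ρ (1 / 4) with h | h
  · have h4 : 1 / 4 ≤ (1 - 2 * ρ) / (1 + ρ) ^ 2 := by
      rw [le_div_iff₀ (by positivity)]
      nlinarith
    have h5 : 0 ≤ ‖κ • x‖ ^ β := by positivity
    nlinarith
  · have h4 : -(1 / 3) ≤ (1 - 2 * ρ) / (1 + ρ) ^ 2 := by
      rw [le_div_iff₀ (by positivity)]
      nlinarith [sq_nonneg (ρ - 2)]
    have h5 : α ≤ ‖κ • x‖ ^ β := by
      refine Real.rpow_le_rpow (by norm_num) ?_ hβ.le
      nlinarith [norm_nonneg (κ • x)]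
    nlinarith

/-- The form of `-Δ + V` is at least `c ^ (2 / (β + 2)) λ_*`; a single partial derivative suffices. -/
theorem le_norm_sq_of_mem_formTriples {β c : ℝ} (hn : 1 ≤ n) (hβ : 0 < β) (hc : 0 < c)
    {V : EuclideanSpace ℝ (Fin n) → ℝ} (hV : ∀ᵐ x, c * ‖x‖ ^ β ≤ V x)
    {q : L2 n × (Fin n → L2 n) × L2 n} (hq : q ∈ formTriples V) :
    c ^ (2 / (β + 2)) * ((1 / 2 : ℝ) ^ β / 4) * ‖q.1‖ ^ 2 ≤
      ∑ i, ‖q.2.1 i‖ ^ 2 + ‖q.2.2‖ ^ 2 := by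
  obtain ⟨hgrad, hW⟩ := hq
  set κ : ℝ := c ^ (1 / (β + 2)) with hκ
  have hκ0 : 0 < κ := by positivity
  have hκ2 : c ^ (2 / (β + 2)) = κ ^ 2 := by
    rw [hκ, ← Real.rpow_natCast, ← Real.rpow_mul hc.le]
    congr 1
    push_cast
    ring
  have hκc : κ ^ (β + 2) = c := by
    rw [hκ, ← Real.rpow_mul hc.le, one_div_mul_cancel (by positivity), Real.rpow_one]
  set α : ℝ := (1 / 2 : ℝ) ^ β with hα
  let i₀ : Fin n := ⟨0, hn⟩
  set m : EuclideanSpace ℝ (Fin n) := EuclideanSpace.single i₀ (1 : ℝ) with hm'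
  have hm : ‖m‖ = 1 := by simp [hm']
  have h1 := integral_le_norm_sq_of_lineDerivOp_eq (hgrad i₀) (hasTemperateGrowth_slope κ α m)
    (hasTemperateGrowth_slopeDeriv κ α m) (hasLineDerivAt_slope κ α hm) (abs_slope_le κ α hm)
    (abs_slopeDeriv_le κ α hm)
  have h2 : ‖q.2.1 i₀‖ ^ 2 ≤ ∑ i, ‖q.2.1 i‖ ^ 2 :=
    Finset.single_le_sum (f := fun i => ‖q.2.1 i‖ ^ 2) (fun i _ => sq_nonneg _)
      (Finset.mem_univ i₀)
  have hbd : Integrable fun x => (slopeDeriv κ α m x - slope κ α m x ^ 2) * ‖q.1 x‖ ^ 2 := by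
    refine (integrable_norm_sq q.1).bdd_mul (c := κ ^ 2 * |α| * 3 + (|κ| * |α|) ^ 2)
      ((hasTemperateGrowth_slopeDeriv κ α m).1.continuous.sub
      ((hasTemperateGrowth_slope κ α m).1.continuous.pow 2)).aestronglyMeasurable
      (.of_forall fun x => ?_)
    refine (norm_sub_le _ _).trans (add_le_add (abs_slopeDeriv_le κ α hm x) ?_)
    rw [norm_pow]
    exact pow_le_pow_left₀ (norm_nonneg _) (abs_slope_le κ α hm x) 2
  have h3 : κ ^ 2 * (α / 4) * ‖q.1‖ ^ 2 ≤
      (∫ x, (slopeDeriv κ α m x - slope κ α m x ^ 2) * ‖q.1 x‖ ^ 2) + ‖q.2.2‖ ^ 2 := by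
    rw [norm_sq_eq_integral, norm_sq_eq_integral q.2.2, ← integral_const_mul,
      ← integral_add hbd (integrable_norm_sq _)]
    refine integral_mono_ae ((integrable_norm_sq _).const_mul _)
      (hbd.add (integrable_norm_sq _)) ?_
    filter_upwards [hV, hW] with x hVx hWx
    have hV0 : 0 ≤ V x := le_trans (by positivity) hVx
    have h4 : ‖q.2.2 x‖ ^ 2 = V x * ‖q.1 x‖ ^ 2 := by
      rw [hWx, norm_mul, mul_pow, Complex.norm_real, Real.norm_eq_abs, sq_abs, Real.sq_sqrt hV0]
    have h5 := le_slopeDeriv_sub_slope_sq_add hβ hκ0 hm x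
    rw [hκc] at h5
    rw [h4, ← add_mul]
    gcongr
    linarith
  rw [hκ2]
  linarith

end LowerBound

/-! ### Finite-dimensional control of `H¹` functions on balls -/

section FrequencyCutoff

open scoped FourierTransform

variable {n : ℕ}

/-- The restriction `1_{|ξ| ≤ M} g` of `g` to frequencies at most `M`. -/
def lowpass (M : ℝ) (g : L2 n) : L2 n :=
  ((Lp.memLp g).indicator
    (Metric.isClosed_closedBall (x := (0 : EuclideanSpace ℝ (Fin n))) (ε := M)).measurableSet).toLp _

theorem coeFn_lowpass (M : ℝ) (g : L2 n) :
    lowpass M g =ᵐ[volume] (Metric.closedBall 0 M).indicator g :=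
  MemLp.coeFn_toLp _

theorem memLp_truncated_exp (M : ℝ) (x : EuclideanSpace ℝ (Fin n)) :
    MemLp ((Metric.closedBall (0 : EuclideanSpace ℝ (Fin n)) M).indicator
      fun ξ => Complex.exp (-(2 * Real.pi * inner ℝ ξ x : ℝ) * Complex.I)) 2 volume := by
  rw [memLp_indicator_iff_restrict Metric.isClosed_closedBall.measurableSet]
  have : IsFiniteMeasure (volume.restrict (Metric.closedBall (0 : EuclideanSpace ℝ (Fin n)) M)) :=
    ⟨by simpa using measure_closedBall_lt_top⟩
  refine MemLp.of_bound (Continuous.aestronglyMeasurable (by fun_prop)) 1 (.of_forall fun ξ => ?_)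
  rw [← Complex.ofReal_neg, Complex.norm_exp_ofReal_mul_I]

/-- The plane wave `ξ ↦ e^{-2πi⟨ξ,x⟩}` truncated to `|ξ| ≤ M`. Its inner product with `𝓕 f` is
the value at `x` of the part of `f` with frequencies at most `M`. -/
def planeWave (M : ℝ) (x : EuclideanSpace ℝ (Fin n)) : L2 n :=
  (memLp_truncated_exp M x).toLp _

theorem coeFn_planeWave (M : ℝ) (x : EuclideanSpace ℝ (Fin n)) :
    planeWave M x =ᵐ[volume] (Metric.closedBall 0 M).indicator
      fun ξ => Complex.exp (-(2 * Real.pi * inner ℝ ξ x : ℝ) * Complex.I) :=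
  MemLp.coeFn_toLp _

theorem norm_planeWave_sub_sq_le (M : ℝ) (x y : EuclideanSpace ℝ (Fin n)) :
    ‖planeWave M x - planeWave M y‖ ^ 2 ≤ (2 * Real.pi * M * ‖x - y‖) ^ 2 *
      volume.real (Metric.closedBall (0 : EuclideanSpace ℝ (Fin n)) M) := by
  rw [norm_sq_eq_integral, mul_comm, ← smul_eq_mul,
    ← integral_indicator_const _ Metric.isClosed_closedBall.measurableSet]
  refine integral_mono_ae (integrable_norm_sq _) ?_ ?_
  · exact (integrable_indicator_iff Metric.isClosed_closedBall.measurableSet).2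
      (integrableOn_const measure_closedBall_lt_top.ne)
  · filter_upwards [Lp.coeFn_sub (planeWave M x) (planeWave M y), coeFn_planeWave M x,
      coeFn_planeWave M y] with ξ h1 h2 h3
    rw [h1, Pi.sub_apply, h2, h3]
    by_cases hξ : ξ ∈ Metric.closedBall (0 : EuclideanSpace ℝ (Fin n)) M
    · simp only [Set.indicator_of_mem hξ]
      have hM : ‖ξ‖ ≤ M := mem_closedBall_zero_iff.1 hξ
      refine pow_le_pow_left₀ (norm_nonneg _) ?_ 2
      have e : Complex.exp (-(2 * Real.pi * inner ℝ ξ x : ℝ) * Complex.I) -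
          Complex.exp (-(2 * Real.pi * inner ℝ ξ y : ℝ) * Complex.I) =
          Complex.exp ((-(2 * Real.pi * inner ℝ ξ y) : ℝ) * Complex.I) *
          (Complex.exp (Complex.I * (-(2 * Real.pi * inner ℝ ξ (x - y)) : ℝ)) - 1) := by
        rw [mul_sub, ← Complex.exp_add, mul_one, inner_sub_right]
        push_cast
        congr 2
        ring
      rw [e, norm_mul, Complex.norm_exp_ofReal_mul_I, one_mul]
      refine Real.norm_exp_I_mul_ofReal_sub_one_le.trans ?_
      rw [norm_neg, Real.norm_eq_abs, abs_mul, abs_of_pos Real.two_pi_pos]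
      have := abs_real_inner_le_norm ξ (x - y)
      have h5 : ‖ξ‖ * ‖x - y‖ ≤ M * ‖x - y‖ := by gcongr
      rw [mul_assoc (2 * Real.pi)]
      gcongr
      linarith
    · simp [Set.indicator_of_notMem hξ]

theorem continuous_planeWave (M : ℝ) :
    Continuous (planeWave M : EuclideanSpace ℝ (Fin n) → L2 n) := by
  set v := volume.real (Metric.closedBall (0 : EuclideanSpace ℝ (Fin n)) M) with hv
  have hv0 : 0 ≤ v := measureReal_nonneg
  refine (LipschitzWith.of_dist_le_mul (K := (2 * Real.pi * |M| * √v).toNNReal)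
    fun x y => ?_).continuous
  rw [dist_eq_norm, dist_eq_norm, Real.coe_toNNReal _ (by positivity)]
  refine le_of_sq_le_sq ?_ (by positivity)
  refine (norm_planeWave_sub_sq_le M x y).trans_eq ?_
  simp only [mul_pow, sq_abs, Real.sq_sqrt hv0, ← hv]
  ring

theorem inner_planeWave_eq_fourierInv (M : ℝ) (g : L2 n) (x : EuclideanSpace ℝ (Fin n)) :
    inner ℂ (planeWave M x) g =
      𝓕⁻ (lowpass M g : EuclideanSpace ℝ (Fin n) → ℂ) x := by
  rw [L2.inner_def, Real.fourierInv_eq']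
  refine integral_congr_ae ?_
  filter_upwards [coeFn_planeWave M x, coeFn_lowpass M g] with ξ h1 h2
  rw [h1, h2]
  by_cases hξ : ξ ∈ Metric.closedBall (0 : EuclideanSpace ℝ (Fin n)) M
  · simp only [Set.indicator_of_mem hξ, RCLike.inner_apply, smul_eq_mul]
    rw [← Complex.exp_conj, mul_comm, map_mul, map_neg, Complex.conj_ofReal, Complex.conj_I,
      neg_mul_neg]
  · simp [Set.indicator_of_notMem hξ]

theorem integrable_lowpass (M : ℝ) (g : L2 n) : Integrable (lowpass M g) volume := by
  rw [integrable_congr (coeFn_lowpass M g),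
    integrable_indicator_iff Metric.isClosed_closedBall.measurableSet]
  have : IsFiniteMeasure (volume.restrict (Metric.closedBall (0 : EuclideanSpace ℝ (Fin n)) M)) :=
    ⟨by simpa using measure_closedBall_lt_top⟩
  exact ((Lp.memLp g).restrict _).integrable (by norm_num)

/-- On `L¹ ∩ L²` the Plancherel transform is given by the Fourier integral; here for functions
with bounded support. Both sides are compared as distributions. -/
theorem fourierInv_lowpass_ae (M : ℝ) (g : L2 n) :
    ∀ᵐ x, (𝓕⁻ (lowpass M g) : L2 n) x = inner ℂ (planeWave M x) g := by
  refine ae_eq_of_integral_contDiff_smul_eq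
    ((Lp.memLp (𝓕⁻ (lowpass M g) : L2 n)).locallyIntegrable (by norm_num))
    (((continuous_planeWave M).inner continuous_const).locallyIntegrable) fun φ hφ hφc => ?_
  have hφ₁ : HasCompactSupport (Complex.ofRealCLM ∘ φ) := hφc.comp_left rfl
  have hφ₂ : ContDiff ℝ (⊤ : ℕ∞) (Complex.ofRealCLM ∘ φ) := by fun_prop
  obtain ⟨ψ, hψx⟩ : ∃ ψ : 𝓢(EuclideanSpace ℝ (Fin n), ℂ), ∀ x, ψ x = (φ x : ℂ) :=
    ⟨hφ₁.toSchwartzMap hφ₂, fun _ => rfl⟩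
  have e1 : ((𝓕⁻ (lowpass M g) : L2 n) : 𝓢'(EuclideanSpace ℝ (Fin n), ℂ)) ψ =
      ∫ ξ, (𝓕⁻ ψ) ξ • lowpass M g ξ := by
    rw [← Lp.fourierInv_toTemperedDistribution_eq, TemperedDistribution.fourierInv_apply,
      Lp.toTemperedDistribution_apply]
  rw [Lp.toTemperedDistribution_apply] at e1
  have e2 := VectorFourier.integral_fourierIntegral_smul_eq_flip
    (L := -innerₗ (EuclideanSpace ℝ (Fin n))) Real.continuous_fourierChar
    (by
      simp only [LinearMap.neg_apply, innerₗ_apply_apply]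
      fun_prop) (ψ.integrable (μ := volume)) (integrable_lowpass M g)
  have e3 : ∀ x, VectorFourier.fourierIntegral Real.fourierChar volume
      (-innerₗ (EuclideanSpace ℝ (Fin n))).flip (lowpass M g) x =
      inner ℂ (planeWave M x) g := fun x => by
    rw [inner_planeWave_eq_fourierInv]
    have : (-innerₗ (EuclideanSpace ℝ (Fin n))).flip = -innerₗ (EuclideanSpace ℝ (Fin n)) := by
      ext a b
      simp [real_inner_comm]
    rw [this]
    rfl
  have e4 : ∀ ξ, (𝓕⁻ ψ) ξ = VectorFourier.fourierIntegral Real.fourierChar volume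
      (-innerₗ (EuclideanSpace ℝ (Fin n))) ψ ξ := fun ξ => by
    rw [SchwartzMap.fourierInv_coe]
    rfl
  simp only [e4] at e1
  rw [e2] at e1
  simp only [e3, hψx] at e1
  simpa only [Complex.real_smul, smul_eq_mul] using e1

/-- Frequencies above `M` are controlled by the gradient. -/
theorem norm_sub_lowpass_sq_le {f : L2 n} {F : Fin n → L2 n} (h : IsGradient f F) {M : ℝ}
    (hM : 0 < M) : ‖𝓕 f - lowpass M (𝓕 f)‖ ^ 2 ≤ (∑ i, ‖F i‖ ^ 2) / M ^ 2 := by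
  have h1 : ∀ᵐ ξ, ∀ i, 𝓕 (F i) ξ = (2 * Real.pi * Complex.I *
      (inner ℝ ξ (EuclideanSpace.single i (1 : ℝ)) : ℝ)) * 𝓕 f ξ :=
    ae_all_iff.2 fun i => fourier_ae_eq_of_lineDerivOp_eq (h i)
  rw [le_div_iff₀ (by positivity), norm_sq_eq_integral, ← integral_mul_const]
  calc _ ≤ ∫ ξ, ∑ i, ‖𝓕 (F i) ξ‖ ^ 2 := by
        refine integral_mono_ae ((integrable_norm_sq _).mul_const _)
          (integrable_finsetSum _ fun i _ => integrable_norm_sq _) ?_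
        filter_upwards [h1, Lp.coeFn_sub (𝓕 f) (lowpass M (𝓕 f)), coeFn_lowpass M (𝓕 f)]
          with ξ h2 h3 h4
        rw [h3, Pi.sub_apply, h4]
        by_cases hξ : ξ ∈ Metric.closedBall (0 : EuclideanSpace ℝ (Fin n)) M
        · rw [Set.indicator_of_mem hξ, sub_self]
          simp only [norm_zero, zero_pow two_ne_zero, zero_mul]
          positivity
        · rw [Set.indicator_of_notMem hξ, sub_zero]
          have h5 : M ≤ ‖ξ‖ := by
            rw [mem_closedBall_zero_iff, not_le] at hξ
            exact hξ.le
          have h6 : ∀ i, ‖𝓕 (F i) ξ‖ ^ 2 = (2 * Real.pi) ^ 2 * ‖𝓕 f ξ‖ ^ 2 * ‖ξ i‖ ^ 2 := by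
            intro i
            rw [h2 i, EuclideanSpace.inner_single_right]
            simp [mul_pow, abs_of_pos Real.pi_pos]
            ring
          simp only [h6]
          rw [← Finset.mul_sum, ← EuclideanSpace.norm_sq_eq]
          have h7 : 1 ≤ (2 * Real.pi) ^ 2 := by nlinarith [Real.pi_gt_three]
          have h8 : M ^ 2 ≤ ‖ξ‖ ^ 2 := by gcongr
          calc ‖𝓕 f ξ‖ ^ 2 * M ^ 2 ≤ ‖𝓕 f ξ‖ ^ 2 * ‖ξ‖ ^ 2 := by gcongr
            _ = 1 * (‖𝓕 f ξ‖ ^ 2 * ‖ξ‖ ^ 2) := (one_mul _).symm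
            _ ≤ (2 * Real.pi) ^ 2 * (‖𝓕 f ξ‖ ^ 2 * ‖ξ‖ ^ 2) := by gcongr
            _ = _ := by ring
    _ = ∑ i, ‖F i‖ ^ 2 := by
        rw [integral_finsetSum _ fun i _ => integrable_norm_sq _]
        simp only [← norm_sq_eq_integral, Lp.norm_fourier_eq]

/-- On a ball, the part of `f` with frequencies at most `M` is controlled by its values at finitely
many points, since `planeWave M` maps the ball to a compact subset of `L²`. -/
theorem exists_setIntegral_lowpass_le (M R : ℝ) {δ : ℝ} (hδ : 0 < δ) :
    ∃ s : Finset (L2 n), ∀ f : L2 n,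
      ∫ x in Metric.closedBall 0 R, ‖(𝓕⁻ (lowpass M (𝓕 f)) : L2 n) x‖ ^ 2 ≤
        2 * volume.real (Metric.closedBall (0 : EuclideanSpace ℝ (Fin n)) R) *
          (∑ k ∈ s, ‖inner ℂ k (𝓕 f)‖ ^ 2 + δ ^ 2 * ‖f‖ ^ 2) := by
  have hK : IsCompact (planeWave M '' Metric.closedBall (0 : EuclideanSpace ℝ (Fin n)) R) :=
    (isCompact_closedBall _ _).image (continuous_planeWave M)
  obtain ⟨t, -, htf, hcov⟩ := Metric.finite_approx_of_totallyBounded hK.totallyBounded δ hδ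
  refine ⟨htf.toFinset, fun f => ?_⟩
  set A := ∑ k ∈ htf.toFinset, ‖inner ℂ k (𝓕 f)‖ ^ 2 with hA
  have hpt : ∀ x ∈ Metric.closedBall (0 : EuclideanSpace ℝ (Fin n)) R,
      ‖inner ℂ (planeWave M x) (𝓕 f)‖ ^ 2 ≤ 2 * (A + δ ^ 2 * ‖f‖ ^ 2) := by
    intro x hx
    obtain ⟨k, hk, hxk⟩ := Set.mem_iUnion₂.1 (hcov (Set.mem_image_of_mem _ hx))
    rw [Metric.mem_ball, dist_eq_norm] at hxk
    have h1 : ‖inner ℂ k (𝓕 f)‖ ^ 2 ≤ A :=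
      Finset.single_le_sum (f := fun k => ‖inner ℂ k (𝓕 f)‖ ^ 2) (fun _ _ => sq_nonneg _)
        (htf.mem_toFinset.2 hk)
    have h2 : ‖inner ℂ (planeWave M x - k) (𝓕 f)‖ ≤ δ * ‖f‖ := by
      refine (norm_inner_le_norm _ _).trans ?_
      rw [Lp.norm_fourier_eq]
      gcongr
    have h3 : ‖inner ℂ (planeWave M x) (𝓕 f)‖ ≤ ‖inner ℂ k (𝓕 f)‖ + δ * ‖f‖ := by
      have : inner ℂ (planeWave M x) (𝓕 f) =
          inner ℂ k (𝓕 f) + inner ℂ (planeWave M x - k) (𝓕 f) := by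
        rw [inner_sub_left]; ring
      rw [this]
      exact (norm_add_le _ _).trans (by gcongr)
    have h4 := pow_le_pow_left₀ (norm_nonneg _) h3 2
    nlinarith [sq_nonneg (‖inner ℂ k (𝓕 f)‖ - δ * ‖f‖)]
  calc _ ≤ ∫ _ in Metric.closedBall (0 : EuclideanSpace ℝ (Fin n)) R,
        2 * (A + δ ^ 2 * ‖f‖ ^ 2) := by
        refine setIntegral_mono_on_ae (integrable_norm_sq _).integrableOn
          (integrableOn_const measure_closedBall_lt_top.ne)
          Metric.isClosed_closedBall.measurableSet ?_
        filter_upwards [fourierInv_lowpass_ae M (𝓕 f)] with x hx hxR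
        rw [hx]
        exact hpt x hxR
    _ = _ := by
        rw [setIntegral_const, smul_eq_mul]
        ring

/-- Outside a large ball the potential controls `f`. -/
theorem setIntegral_compl_closedBall_le {β c R : ℝ} (hβ : 0 < β) (hc : 0 < c) (hR : 0 < R)
    {V : EuclideanSpace ℝ (Fin n) → ℝ} (hV : ∀ᵐ x, c * ‖x‖ ^ β ≤ V x)
    {q : L2 n × (Fin n → L2 n) × L2 n} (hq : q ∈ formTriples V) :
    ∫ x in (Metric.closedBall 0 R)ᶜ, ‖q.1 x‖ ^ 2 ≤ ‖q.2.2‖ ^ 2 / (c * R ^ β) := by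
  have hm : MeasurableSet (Metric.closedBall (0 : EuclideanSpace ℝ (Fin n)) R)ᶜ :=
    Metric.isClosed_closedBall.measurableSet.compl
  rw [le_div_iff₀ (by positivity), norm_sq_eq_integral, ← integral_mul_const]
  refine le_trans (setIntegral_mono_on_ae (g := fun x => ‖q.2.2 x‖ ^ 2)
    ((integrable_norm_sq _).mul_const _).integrableOn (integrable_norm_sq _).integrableOn hm ?_)
    (setIntegral_le_integral (integrable_norm_sq _) (.of_forall fun _ => sq_nonneg _))
  filter_upwards [hV, hq.2] with x hVx hWx hx
  rw [Set.mem_compl_iff, mem_closedBall_zero_iff, not_le] at hx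
  have h1 : c * R ^ β ≤ V x := le_trans (by gcongr) hVx
  have h0 : 0 < c * R ^ β := by positivity
  rw [hWx, norm_mul, mul_pow, Complex.norm_real, Real.norm_eq_abs, sq_abs,
    Real.sq_sqrt (h0.le.trans h1), mul_comm]
  gcongr

theorem setIntegral_norm_sq_le_add (B : Set (EuclideanSpace ℝ (Fin n))) (f g : L2 n) :
    ∫ x in B, ‖f x‖ ^ 2 ≤ 2 * (∫ x in B, ‖g x‖ ^ 2) + 2 * ‖f - g‖ ^ 2 := by
  have h1 : ∫ x in B, ‖(f - g : L2 n) x‖ ^ 2 ≤ ‖f - g‖ ^ 2 := by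
    rw [norm_sq_eq_integral]
    exact setIntegral_le_integral (integrable_norm_sq _) (.of_forall fun _ => sq_nonneg _)
  have h2 : ∫ x in B, ‖f x‖ ^ 2 ≤
      ∫ x in B, (2 * ‖g x‖ ^ 2 + 2 * ‖(f - g : L2 n) x‖ ^ 2) := by
    refine integral_mono_ae (integrable_norm_sq _).integrableOn
      (((integrable_norm_sq _).const_mul 2).add
        ((integrable_norm_sq _).const_mul 2)).integrableOn ?_
    filter_upwards [ae_restrict_of_ae (Lp.coeFn_sub f g)] with x hx
    simp only [hx, Pi.sub_apply]
    have h3 : ‖f x‖ ≤ ‖g x‖ + ‖f x - g x‖ := by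
      simpa using norm_add_le (g x) (f x - g x)
    have h4 := pow_le_pow_left₀ (norm_nonneg _) h3 2
    nlinarith [sq_nonneg (‖g x‖ - ‖f x - g x‖)]
  rw [integral_add ((integrable_norm_sq _).const_mul 2).integrableOn
    ((integrable_norm_sq _).const_mul 2).integrableOn, integral_const_mul,
    integral_const_mul] at h2
  linarith

/-- The form domain embeds compactly into `L²`, in quantitative form: up to a small multiple of the
form norm, the `L²` norm is controlled by finitely many linear functionals. -/
theorem exists_norm_sq_le_of_mem_formTriples {β c ε : ℝ} (hβ : 0 < β) (hc : 0 < c) (hε : 0 < ε)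
    {V : EuclideanSpace ℝ (Fin n) → ℝ} (hV : ∀ᵐ x, c * ‖x‖ ^ β ≤ V x) :
    ∃ (C : ℝ) (s : Finset (L2 n)), 0 ≤ C ∧ ∀ q ∈ formTriples V,
      ‖q.1‖ ^ 2 ≤ ε * (‖q.1‖ ^ 2 + ∑ i, ‖q.2.1 i‖ ^ 2 + ‖q.2.2‖ ^ 2) +
        C * ∑ k ∈ s, ‖inner ℂ k (𝓕 q.1)‖ ^ 2 := by
  -- `R` takes care of the tail in space, `M` of the tail in frequency, and `δ` of the
  -- approximation of the plane waves at the points of the ball of radius `R`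
  obtain ⟨R, hR, hR0⟩ : ∃ R : ℝ, 1 / (c * R ^ β) ≤ ε ∧ 0 < R := by
    refine ⟨(1 / (c * ε)) ^ (1 / β), ?_, by positivity⟩
    rw [← Real.rpow_mul (by positivity), one_div_mul_cancel hβ.ne', Real.rpow_one]
    apply le_of_eq
    field_simp
  obtain ⟨M, hM, hM0⟩ : ∃ M : ℝ, 2 / M ^ 2 ≤ ε ∧ 0 < M := by
    refine ⟨√(2 / ε), ?_, by positivity⟩
    rw [Real.sq_sqrt (by positivity)]
    apply le_of_eq
    field_simp
  set v := volume.real (Metric.closedBall (0 : EuclideanSpace ℝ (Fin n)) R) with hv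
  have hv0 : 0 ≤ v := measureReal_nonneg
  obtain ⟨δ, hδ, hδ0⟩ : ∃ δ : ℝ, 4 * v * δ ^ 2 ≤ ε ∧ 0 < δ := by
    refine ⟨√(ε / (4 * v + 1)), ?_, by positivity⟩
    rw [Real.sq_sqrt (by positivity), mul_div_assoc', div_le_iff₀ (by positivity)]
    nlinarith
  obtain ⟨s, hs⟩ := exists_setIntegral_lowpass_le (n := n) M R hδ0
  refine ⟨4 * v, s, by positivity, fun q hq => ?_⟩
  set f := q.1 with hf
  set lo : L2 n := 𝓕⁻ (lowpass M (𝓕 f)) with hlo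
  have hhi : ‖f - lo‖ ^ 2 ≤ (∑ i, ‖q.2.1 i‖ ^ 2) / M ^ 2 := by
    have e : 𝓕 (f - lo) = 𝓕 f - lowpass M (𝓕 f) := by
      rw [sub_eq_add_neg, FourierTransform.fourier_add, FourierTransform.fourier_neg, hlo,
        FourierTransform.fourier_fourierInv_eq, sub_eq_add_neg]
    rw [← Lp.norm_fourier_eq, e]
    exact norm_sub_lowpass_sq_le hq.1 hM0
  have hin := setIntegral_norm_sq_le_add (Metric.closedBall 0 R) f lo
  have hsplit := integral_add_compl
    (Metric.isClosed_closedBall (x := (0 : EuclideanSpace ℝ (Fin n))) (ε := R)).measurableSet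
    (integrable_norm_sq f)
  rw [← norm_sq_eq_integral] at hsplit
  have hout := setIntegral_compl_closedBall_le hβ hc hR0 hV hq
  have hlow := hs f
  rw [← hlo, ← hv] at hlow
  have b1 : ‖q.2.2‖ ^ 2 / (c * R ^ β) ≤ ε * ‖q.2.2‖ ^ 2 := by
    rw [div_eq_mul_one_div, mul_comm]
    exact mul_le_mul_of_nonneg_right hR (sq_nonneg _)
  have b2 : 2 * ((∑ i, ‖q.2.1 i‖ ^ 2) / M ^ 2) ≤ ε * ∑ i, ‖q.2.1 i‖ ^ 2 := by
    rw [mul_div_assoc', mul_comm 2, mul_div_assoc, mul_comm]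
    exact mul_le_mul_of_nonneg_right hM (Finset.sum_nonneg fun _ _ => sq_nonneg _)
  have b3 : 4 * v * δ ^ 2 * ‖f‖ ^ 2 ≤ ε * ‖f‖ ^ 2 :=
    mul_le_mul_of_nonneg_right hδ (sq_nonneg _)
  rw [← hf] at hout
  linarith

end FrequencyCutoff

/-! ### The form domain as a Hilbert space and the resolvent -/

section FormDomain

open scoped FourierTransform

variable {n : ℕ}

theorem isClosed_formTriples (V : EuclideanSpace ℝ (Fin n) → ℝ) :
    IsClosed (formTriples V : Set (L2 n × (Fin n → L2 n) × L2 n)) := by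
  have h1 : IsClosed {p : L2 n × (Fin n → L2 n) × L2 n | IsGradient p.1 p.2.1} := by
    simp only [IsGradient, Set.ofPred_forall]
    refine isClosed_iInter fun i => isClosed_eq ?_ ?_
    · exact (LineDeriv.lineDerivOpCLM ℂ 𝓢'(EuclideanSpace ℝ (Fin n), ℂ)
        (EuclideanSpace.single i (1 : ℝ)) ∘L
        Lp.toTemperedDistributionCLM ℂ volume 2).continuous.comp continuous_fst
    · exact (Lp.toTemperedDistributionCLM ℂ volume 2).continuous.comp
        ((continuous_apply i).comp (continuous_fst.comp continuous_snd))
  -- `L²` convergence gives pointwise convergence along a subsequence, first of `f`, then of `√V f`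
  refine h1.inter (IsSeqClosed.isClosed fun p q hp hpq => ?_)
  have t1 := tendstoInMeasure_of_tendsto_Lp ((continuous_fst.tendsto q).comp hpq)
  obtain ⟨u, hu, hu'⟩ := t1.exists_seq_tendsto_ae
  have t2 := tendstoInMeasure_of_tendsto_Lp
    (((continuous_snd.comp continuous_snd).tendsto q).comp (hpq.comp hu.tendsto_atTop))
  obtain ⟨w, hw, hw'⟩ := t2.exists_seq_tendsto_ae
  have hp' := ae_all_iff.2 hp
  filter_upwards [hu', hw', hp'] with x a b d
  refine tendsto_nhds_unique b ?_
  have := (a.comp hw.tendsto_atTop).const_mul (Real.sqrt (V x) : ℂ)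
  refine this.congr fun k => ?_
  exact (d (u (w k))).symm

variable (n) in
/-- The Hilbert space `L² ⊕ L² ⊕ (L²)ⁿ` containing the triples `(f, √V f, ∇f)`; its inner product
restricts to the form of `1 - Δ + V` on these triples. -/
def TripleSpace : Type :=
  WithLp 2 (L2 n × WithLp 2 (L2 n × PiLp 2 fun _ : Fin n => L2 n))

instance : NormedAddCommGroup (TripleSpace n) :=
  inferInstanceAs (NormedAddCommGroup
    (WithLp 2 (L2 n × WithLp 2 (L2 n × PiLp 2 fun _ : Fin n => L2 n))))

instance : InnerProductSpace ℂ (TripleSpace n) :=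
  inferInstanceAs (InnerProductSpace ℂ
    (WithLp 2 (L2 n × WithLp 2 (L2 n × PiLp 2 fun _ : Fin n => L2 n))))

instance : CompleteSpace (TripleSpace n) :=
  inferInstanceAs (CompleteSpace
    (WithLp 2 (L2 n × WithLp 2 (L2 n × PiLp 2 fun _ : Fin n => L2 n))))

variable (n) in
/-- The identification of `TripleSpace n` with the product space in which the form triples live. -/
def toTriple : TripleSpace n →L[ℂ] L2 n × (Fin n → L2 n) × L2 n where
  toFun q := (q.fst, fun i => q.snd.snd i, q.snd.fst)
  map_add' _ _ := rfl
  map_smul' _ _ := rfl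
  cont := by fun_prop

/-- The inverse of `toTriple`. -/
def ofTriple (q : L2 n × (Fin n → L2 n) × L2 n) : TripleSpace n :=
  WithLp.toLp 2 (q.1, WithLp.toLp 2 (q.2.2, WithLp.toLp 2 q.2.1))

@[simp]
theorem toTriple_ofTriple (q : L2 n × (Fin n → L2 n) × L2 n) : toTriple n (ofTriple q) = q := rfl

theorem inner_eq_form_add (p q : TripleSpace n) :
    inner ℂ p q = form (toTriple n p) (toTriple n q) +
      inner ℂ (toTriple n p).1 (toTriple n q).1 := by
  have h1 : inner ℂ p q = inner ℂ p.fst q.fst + inner ℂ p.snd q.snd :=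
    WithLp.prod_inner_apply _ _
  rw [h1, WithLp.prod_inner_apply, PiLp.inner_apply, add_comm, add_comm (inner ℂ _ _)]
  rfl

theorem norm_sq_tripleSpace (q : TripleSpace n) :
    ‖q‖ ^ 2 = ‖(toTriple n q).1‖ ^ 2 + (∑ i, ‖(toTriple n q).2.1 i‖ ^ 2 +
      ‖(toTriple n q).2.2‖ ^ 2) := by
  have h1 : ‖q‖ ^ 2 = ‖q.fst‖ ^ 2 + ‖q.snd‖ ^ 2 := WithLp.prod_norm_sq_eq_of_L2 _
  rw [h1, WithLp.prod_norm_sq_eq_of_L2, PiLp.norm_sq_eq_of_L2, add_comm (‖q.snd.fst‖ ^ 2)]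
  rfl

/-- The form domain as a closed subspace of `TripleSpace n`. -/
def formDomain (V : EuclideanSpace ℝ (Fin n) → ℝ) : Submodule ℂ (TripleSpace n) :=
  (formTriples V).comap (toTriple n).toLinearMap

theorem mem_formDomain {V : EuclideanSpace ℝ (Fin n) → ℝ} {q : TripleSpace n} :
    q ∈ formDomain V ↔ toTriple n q ∈ formTriples V := Iff.rfl

instance (V : EuclideanSpace ℝ (Fin n) → ℝ) : CompleteSpace (formDomain V) :=
  ((isClosed_formTriples V).preimage (toTriple n).continuous).completeSpace_coe

/-- The embedding of the form domain into `L²`. -/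
def embedding (V : EuclideanSpace ℝ (Fin n) → ℝ) : formDomain V →L[ℂ] L2 n :=
  ContinuousLinearMap.fst ℂ _ _ ∘L toTriple n ∘L (formDomain V).subtypeL

theorem embedding_apply (V : EuclideanSpace ℝ (Fin n) → ℝ) (q : formDomain V) :
    embedding V q = (toTriple n q).1 := rfl

/-- The resolvent `(1 - Δ + V)⁻¹`, obtained from the Riesz representation theorem on the form
domain. -/
def resolvent (V : EuclideanSpace ℝ (Fin n) → ℝ) : L2 n →L[ℂ] L2 n :=
  embedding V ∘L ContinuousLinearMap.adjoint (embedding V)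

/-- The weak formulation of `(1 - Δ + V) a = a + b` says that the triple of `a` is the Riesz
representative `J* (a + b)` of the functional `p ↦ ⟨p, a + b⟩`, with `J` the embedding. -/
theorem mem_operatorGraph_iff (V : EuclideanSpace ℝ (Fin n) → ℝ) (a b : L2 n) :
    (a, b) ∈ operatorGraph V ↔ a = resolvent V (a + b) := by
  constructor
  · rintro ⟨q, hq, rfl, h⟩
    have hq' : ofTriple q ∈ formDomain V := hq
    have key : (⟨ofTriple q, hq'⟩ : formDomain V) = ContinuousLinearMap.adjoint (embedding V) (q.1 + b) := by
      refine ext_inner_left ℂ fun p => ?_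
      rw [ContinuousLinearMap.adjoint_inner_right, Submodule.coe_inner, inner_eq_form_add,
        toTriple_ofTriple, h _ (mem_formDomain.1 p.2), inner_add_right, embedding_apply, add_comm]
    change q.1 = embedding V (ContinuousLinearMap.adjoint (embedding V) (q.1 + b))
    rw [← key]
    rfl
  · intro h
    set q := ContinuousLinearMap.adjoint (embedding V) (a + b) with hq
    have ha : (toTriple n q).1 = a := h.symm
    refine ⟨toTriple n q, q.2, ha, fun p hp => ?_⟩
    have hp' : ofTriple p ∈ formDomain V := hp
    have key : inner ℂ (⟨ofTriple p, hp'⟩ : formDomain V) q = inner ℂ p.1 (a + b) := by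
      rw [hq, ContinuousLinearMap.adjoint_inner_right]
      rfl
    rw [Submodule.coe_inner, inner_eq_form_add, toTriple_ofTriple, inner_add_right, ha] at key
    exact add_right_cancel (key.trans (add_comm _ _))

theorem mem_graph_hamiltonian_iff (V : EuclideanSpace ℝ (Fin n) → ℝ) (a b : L2 n)
    (hinj : Function.Injective (resolvent V)) :
    (a, b) ∈ (hamiltonian V).graph ↔ a = resolvent V (a + b) := by
  rw [hamiltonian, Submodule.toLinearPMap_graph_eq, mem_operatorGraph_iff]
  rintro ⟨x, y⟩ hx hx'
  dsimp only at hx'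
  rw [mem_operatorGraph_iff, hx', zero_add] at hx
  exact hinj (by rw [← hx, map_zero])

theorem isPositive_resolvent (V : EuclideanSpace ℝ (Fin n) → ℝ) : (resolvent V).IsPositive :=
  ContinuousLinearMap.isPositive_self_comp_adjoint _

theorem mem_formTriples_of_schwartz {V : EuclideanSpace ℝ (Fin n) → ℝ}
    (ψ : 𝓢(EuclideanSpace ℝ (Fin n), ℂ))
    (hW : MemLp (fun x => (Real.sqrt (V x) : ℂ) * ψ x) 2 volume) :
    ((ψ.toLp 2, fun i =>
      (∂_{EuclideanSpace.single i (1 : ℝ)} ψ : 𝓢(EuclideanSpace ℝ (Fin n), ℂ)).toLp 2,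
      hW.toLp _) : L2 n × (Fin n → L2 n) × L2 n) ∈ formTriples V := by
  refine ⟨fun i => ?_, ?_⟩
  · dsimp only
    rw [Lp.toTemperedDistribution_toLp_eq, Lp.toTemperedDistribution_toLp_eq,
      TemperedDistribution.lineDerivOp_toTemperedDistributionCLM_eq]
  · filter_upwards [hW.coeFn_toLp, ψ.coeFn_toLp 2 volume] with x h1 h2
    rw [h1, h2]

/-- Test functions lie in the form domain of a locally integrable potential, and they separate the
points of `L²`. -/
theorem eq_zero_of_forall_inner_formTriples {V : EuclideanSpace ℝ (Fin n) → ℝ}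
    (hV : LocallyIntegrable V volume) (hV0 : ∀ᵐ x, 0 ≤ V x) {g : L2 n}
    (hg : ∀ q ∈ formTriples V, inner ℂ q.1 g = 0) : g = 0 := by
  rw [Lp.eq_zero_iff_ae_eq_zero]
  refine ae_eq_zero_of_integral_contDiff_smul_eq_zero
    ((Lp.memLp g).locallyIntegrable (by norm_num)) fun φ hφ hφc => ?_
  have hφ₁ : HasCompactSupport (Complex.ofRealCLM ∘ φ) := hφc.comp_left rfl
  have hφ₂ : ContDiff ℝ (⊤ : ℕ∞) (Complex.ofRealCLM ∘ φ) := by fun_prop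
  obtain ⟨ψ, hψx⟩ : ∃ ψ : 𝓢(EuclideanSpace ℝ (Fin n), ℂ), ∀ x, ψ x = (φ x : ℂ) :=
    ⟨hφ₁.toSchwartzMap hφ₂, fun _ => rfl⟩
  have hW : MemLp (fun x => (Real.sqrt (V x) : ℂ) * ψ x) 2 volume := by
    have hmeas : AEStronglyMeasurable (fun x => (Real.sqrt (V x) : ℂ) * ψ x) volume :=
      (Complex.continuous_ofReal.comp_aestronglyMeasurable
        (Real.continuous_sqrt.comp_aestronglyMeasurable hV.aestronglyMeasurable)).mul
        ψ.continuous.aestronglyMeasurable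
    rw [memLp_two_iff_integrable_sq_norm hmeas]
    have hint : Integrable (fun x => (φ x) ^ 2 * V x) volume := by
      have := hV.integrable_smul_left_of_hasCompactSupport (g := fun x => φ x ^ 2)
        (hφ.continuous.pow 2) (hφc.comp_left (g := fun y : ℝ => y ^ 2) (by simp))
      simpa only [smul_eq_mul] using this
    refine hint.congr ?_
    filter_upwards [hV0] with x hx
    rw [hψx, norm_mul, mul_pow, Complex.norm_real, Complex.norm_real, Real.norm_eq_abs,
      Real.norm_eq_abs, sq_abs, sq_abs, Real.sq_sqrt hx, mul_comm]
  have h0 := hg _ (mem_formTriples_of_schwartz ψ hW)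
  rw [L2.inner_def] at h0
  rw [← h0]
  refine integral_congr_ae ?_
  filter_upwards [ψ.coeFn_toLp 2 volume] with x h2
  rw [h2, RCLike.inner_apply, hψx, Complex.conj_ofReal, Complex.real_smul, mul_comm]

theorem injective_resolvent {V : EuclideanSpace ℝ (Fin n) → ℝ}
    (hV : LocallyIntegrable V volume) (hV0 : ∀ᵐ x, 0 ≤ V x) :
    Function.Injective (resolvent V) := by
  rw [injective_iff_map_eq_zero]
  intro u hu
  have h1 : inner ℂ (ContinuousLinearMap.adjoint (embedding V) u) (ContinuousLinearMap.adjoint (embedding V) u) = 0 := by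
    rw [ContinuousLinearMap.adjoint_inner_left]
    change inner ℂ u (resolvent V u) = 0
    rw [hu, inner_zero_right]
  rw [inner_self_eq_zero] at h1
  refine eq_zero_of_forall_inner_formTriples hV hV0 fun q hq => ?_
  change inner ℂ (embedding V ⟨ofTriple q, hq⟩) u = 0
  rw [← ContinuousLinearMap.adjoint_inner_right, h1, inner_zero_right]

theorem isCompactOperator_resolvent {β c : ℝ} (hβ : 0 < β) (hc : 0 < c)
    {V : EuclideanSpace ℝ (Fin n) → ℝ} (hV : ∀ᵐ x, c * ‖x‖ ^ β ≤ V x) :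
    IsCompactOperator (resolvent V) := by
  suffices h : IsCompactOperator (embedding V) from h.comp_clm _
  refine isCompactOperator_of_forall_norm_le _ fun ε hε => ?_
  obtain ⟨C, s, hC, hs⟩ := exists_norm_sq_le_of_mem_formTriples hβ hc (pow_pos hε 2) hV
  let e := s.equivFin
  let Φ : formDomain V →L[ℂ] (Fin s.card → ℂ) := ContinuousLinearMap.pi fun j =>
    ((√(C * s.card) : ℝ) : ℂ) • (innerSL ℂ ((e.symm j : L2 n)) ∘L
      ((Lp.fourierTransformₗᵢ (EuclideanSpace ℝ (Fin n)) ℂ).toContinuousLinearEquiv :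
        L2 n →L[ℂ] L2 n) ∘L embedding V)
  have hΦ : ∀ q j, Φ q j = ((√(C * s.card) : ℝ) : ℂ) *
      inner ℂ (e.symm j : L2 n) (𝓕 (embedding V q)) := fun q j => rfl
  refine ⟨s.card, Φ, fun q => ?_⟩
  have h1 := hs _ (mem_formDomain.1 q.2)
  have h2 : C * ∑ k ∈ s, ‖inner ℂ k (𝓕 (embedding V q))‖ ^ 2 ≤ ‖Φ q‖ ^ 2 := by
    have h3 : ∀ k ∈ s, C * s.card * ‖inner ℂ k (𝓕 (embedding V q))‖ ^ 2 ≤ ‖Φ q‖ ^ 2 := by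
      intro k hk
      have h4 := pow_le_pow_left₀ (norm_nonneg _) (norm_le_pi_norm (Φ q) (e ⟨k, hk⟩)) 2
      rwa [hΦ, Equiv.symm_apply_apply, norm_mul, mul_pow, Complex.norm_real, Real.norm_eq_abs,
        sq_abs, Real.sq_sqrt (by positivity)] at h4
    rcases s.eq_empty_or_nonempty with rfl | hne
    · rw [Finset.sum_empty, mul_zero]
      positivity
    · have hcard : (0 : ℝ) < s.card := by exact_mod_cast hne.card_pos
      have h5 := Finset.sum_le_sum h3
      rw [Finset.sum_const, nsmul_eq_mul, ← Finset.mul_sum, mul_comm C, mul_assoc] at h5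
      exact le_of_mul_le_mul_left h5 hcard
  have h3 := norm_sq_tripleSpace (q : TripleSpace n)
  rw [← add_assoc] at h3
  rw [← h3] at h1
  refine le_of_sq_le_sq ?_ (by positivity)
  have h6 : ‖embedding V q‖ ^ 2 ≤ ε ^ 2 * ‖q‖ ^ 2 + ‖Φ q‖ ^ 2 := h1.trans (add_le_add_right h2 _)
  have h7 : 0 ≤ ε * ‖q‖ * ‖Φ q‖ := by positivity
  nlinarith

/-- If the form of `-Δ + V` is at least `μ`, then `(1 - Δ + V)⁻¹ ≤ 1 / (1 + μ)`. -/
theorem norm_resolvent_le {V : EuclideanSpace ℝ (Fin n) → ℝ} {μ : ℝ} (hμ : 0 ≤ μ)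
    (h : ∀ q ∈ formTriples V, μ * ‖q.1‖ ^ 2 ≤ ∑ i, ‖q.2.1 i‖ ^ 2 + ‖q.2.2‖ ^ 2) :
    ‖resolvent V‖ ≤ 1 / (1 + μ) := by
  have h1 : ‖embedding V‖ ≤ √(1 / (1 + μ)) := by
    refine ContinuousLinearMap.opNorm_le_bound _ (Real.sqrt_nonneg _) fun q => ?_
    refine le_of_sq_le_sq ?_ (by positivity)
    rw [mul_pow, Real.sq_sqrt (by positivity), div_mul_eq_mul_div, one_mul,
      le_div_iff₀ (by positivity)]
    have h2 := norm_sq_tripleSpace (q : TripleSpace n)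
    have h3 := h _ (mem_formDomain.1 q.2)
    rw [← embedding_apply] at h2 h3
    change _ ≤ ‖(q : TripleSpace n)‖ ^ 2
    linarith
  refine (ContinuousLinearMap.opNorm_comp_le _ _).trans ?_
  rw [LinearIsometryEquiv.norm_map]
  calc ‖embedding V‖ * ‖embedding V‖ ≤ √(1 / (1 + μ)) * √(1 / (1 + μ)) := by gcongr
    _ = _ := Real.mul_self_sqrt (by positivity)

instance : Nontrivial (L2 n) := by
  refine ⟨indicatorConstLp 2 (Metric.isOpen_ball (x := (0 : EuclideanSpace ℝ (Fin n)))
    (ε := 1)).measurableSet measure_ball_lt_top.ne 1, 0, ?_⟩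
  rw [← norm_pos_iff, norm_indicatorConstLp (by norm_num) (by norm_num), norm_one, one_mul]
  have := Metric.measure_ball_pos volume (0 : EuclideanSpace ℝ (Fin n)) one_pos
  exact Real.rpow_pos_of_pos (ENNReal.toReal_pos this.ne' measure_ball_lt_top.ne) _

end FormDomain

end Schrodinger

end

theorem proposition2p2 (n : ℕ) (hn : 1 ≤ n) (β : ℝ) (hβ : 0 < β) :
    ∃ lam : ℝ, 0 < lam ∧
      ∀ (c : ℝ), 0 < c → ∀ V : EuclideanSpace ℝ (Fin n) → ℝ,
        LocallyIntegrable V volume →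
        (∀ᵐ x : EuclideanSpace ℝ (Fin n), c * ‖x‖ ^ β ≤ V x) →
          -- the operator is self-adjoint and has a lowest eigenvalue, bounded below as claimed
          IsSelfAdjoint (Schrodinger.hamiltonian V) ∧
          (∃ lam0 : ℝ,
            IsLeast {a : ℝ | Schrodinger.IsEigenvalue (Schrodinger.hamiltonian V) a} lam0 ∧
              c ^ (2 / (β + 2)) * lam ≤ lam0) ∧
          -- the decay of the fractional heat semigroup of the scaled operator
          ∀ r : ℝ, 0 < r →
            (∃ S, Schrodinger.IsInverseOneAdd
              (Schrodinger.hamiltonian fun x => r * V x) S) ∧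
            ∀ s t : ℝ, 0 < s → 0 < t → ∀ f : Schrodinger.L2 n,
              ‖Schrodinger.expNegPow (Schrodinger.hamiltonian fun x => r * V x) s t f‖ ≤
                Real.exp (-t * r ^ (2 * s / (β + 2)) * (c ^ (2 / (β + 2)) * lam) ^ s) * ‖f‖ := by
  refine ⟨(1 / 2 : ℝ) ^ β / 4, by positivity, fun c hc V hVloc hV => ?_⟩
  have hinj : ∀ (c : ℝ), 0 < c → ∀ V : EuclideanSpace ℝ (Fin n) → ℝ,
      LocallyIntegrable V volume → (∀ᵐ x : EuclideanSpace ℝ (Fin n), c * ‖x‖ ^ β ≤ V x) →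
      Function.Injective (Schrodinger.resolvent V) := fun c hc V hVloc hV =>
    Schrodinger.injective_resolvent hVloc (hV.mono fun x hx => le_trans (by positivity) hx)
  have hnorm : ∀ (c : ℝ), 0 < c → ∀ V : EuclideanSpace ℝ (Fin n) → ℝ,
      (∀ᵐ x : EuclideanSpace ℝ (Fin n), c * ‖x‖ ^ β ≤ V x) →
      ‖Schrodinger.resolvent V‖ ≤ 1 / (1 + c ^ (2 / (β + 2)) * ((1 / 2 : ℝ) ^ β / 4)) :=
    fun c hc V hV => Schrodinger.norm_resolvent_le (by positivity) fun q hq =>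
      Schrodinger.le_norm_sq_of_mem_formTriples hn hβ hc hV hq
  have hi := hinj c hc V hVloc hV
  have hgraph := fun a b => Schrodinger.mem_graph_hamiltonian_iff V a b hi
  have hpos := Schrodinger.isPositive_resolvent V
  refine ⟨Schrodinger.isSelfAdjoint_of_graph hpos.isSelfAdjoint hi hgraph,
    ⟨_, Schrodinger.isLeast_eigenvalue hpos hi
      (Schrodinger.isCompactOperator_resolvent hβ hc hV) hgraph, ?_⟩, fun r hr => ?_⟩
  · have hS0 : 0 < ‖Schrodinger.resolvent V‖ := by
      rw [norm_pos_iff]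
      intro h0
      obtain ⟨x, hx⟩ := exists_ne (0 : Schrodinger.L2 n)
      exact hx (hi (by simp [h0]))
    have h1 := hnorm c hc V hV
    rw [le_div_iff₀ (by positivity)] at h1
    rw [le_sub_iff_add_le, le_div_iff₀ hS0]
    linarith
  · have hVr : ∀ᵐ x : EuclideanSpace ℝ (Fin n), (r * c) * ‖x‖ ^ β ≤ r * V x := by
      filter_upwards [hV] with x hx
      rw [mul_assoc]
      gcongr
    have hir := hinj (r * c) (by positivity) (fun x => r * V x) (hVloc.smul r) hVr
    have hinv := Schrodinger.isInverseOneAdd_of_graph fun a b =>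
      Schrodinger.mem_graph_hamiltonian_iff (fun x => r * V x) a b hir
    refine ⟨⟨_, hinv⟩, fun s t hs ht f => ?_⟩
    refine (ContinuousLinearMap.le_opNorm _ f).trans ?_
    gcongr
    refine (Schrodinger.norm_expNegPow_le hs ht (by positivity) hinv
      (hnorm (r * c) (by positivity) _ hVr)).trans_eq ?_
    rw [Real.mul_rpow hr.le hc.le, mul_assoc, Real.mul_rpow (by positivity) (by positivity),
      ← Real.rpow_mul hr.le, mul_assoc]
    congr 4
    ring
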